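/- Let $n\ge 2$. A convex body in $\mathbb R^n$ is a compact convex set with non-empty interior; $|\cdot|$ denotes both volume and the Euclidean norm. For a convex body $K$ there is a volume preserving affine map $A$ of $\mathbb R^n$, and a number $M_K>0$ which does not depend on the choice of such an $A$, with $$\int_{AK}\langle x,y\rangle\,dx=0,\qquad \int_{AK}\langle x,y\rangle^2\,dx=M_K^2|y|^2\qquad\text{for all } y\in\mathbb R^n ,$$ and the isotropy constant of $K$ is $L_K=M_K/|K|^{\frac{n+2}{2n}}$. A convex body $K$ is a local maximizer of $L_K$ in a class $\mathcal C$ of convex bodies if $K\in\mathcal C$ and, for some $\varepsilon>0$, $L_{K'}\le L_K$ for all $K'\in\mathcal C$ at Hausdorff distance less than $\varepsilon$ from $K$. The body $K$ has positive generalized Gauss curvature at $X_0\in\partial K$ if there exist a unit inner normal $N$ of $K$ at $X_0$ (i.e. $|N|=1$ and $\langle x-X_0,N\rangle\ge 0$ for all $x\in K$) and a positive definite quadratic form $q$ on $N^\perp$ such that for every $\varepsilon>0$ there is $a>0$ such that, for all $Y\in N^\perp$ and $y\in\mathbb R$ with $X_0+Y+yN\in\partial K$ and $|Y+yN|\le a$,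 $$(1-\varepsilon)q(Y)\le y\le(1+\varepsilon)q(Y).$$ Theorem. (i) If a convex body $K$ in $\mathbb R^n$ is a local maximizer of $L_K$ in the class of all convex bodies, then $K$ does not have positive generalized Gauss curvature at any point of its boundary. (ii) Let $c\in\mathbb R^n$. If a convex body $K$ which is centrally symmetric about $c$ is a local maximizer of $L_K$ in the class of convex bodies that are centrally symmetric about $c$, then $K$ does not have positive generalized Gauss curvature at any point of its boundary. -/

import Mathlib

open MeasureTheory
open scoped RealInnerProductSpace

/-- The convex bodies of `ℝⁿ`: compact convex sets with non-empty interior. Mathlib's `ConvexBody`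
only asks for a non-empty set, hence the extra condition. The metric (and the topology) of
`ConvexBody` is that of the Hausdorff distance. -/
def properBodies (n : ℕ) : Set (ConvexBody (EuclideanSpace ℝ (Fin n))) :=
  {K | (interior (K : Set (EuclideanSpace ℝ (Fin n)))).Nonempty}

/-- `S` is in isotropic position with constant `M`: for all `y`,
`∫_S ⟨x, y⟩ dx = 0` and `∫_S ⟨x, y⟩² dx = M² |y|²` (no normalization of the volume of `S`). -/
def IsIsotropicWith {n : ℕ} (S : Set (EuclideanSpace ℝ (Fin n))) (M : ℝ) : Prop :=
  ∀ y : EuclideanSpace ℝ (Fin n),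
    (∫ x in S, ⟪x, y⟫) = 0 ∧ (∫ x in S, ⟪x, y⟫ ^ 2) = M ^ 2 * ‖y‖ ^ 2

/-- The constant `M_K`: the number `M > 0` such that some volume preserving affine image `A K` of
`K` is in isotropic position with constant `M`. For a compact convex set with non-empty interior in
positive dimension there is exactly one such number, and the supremum below is over a singleton. -/
noncomputable def isotropicMoment {n : ℕ} (K : ConvexBody (EuclideanSpace ℝ (Fin n))) : ℝ :=
  sSup {M : ℝ | 0 < M ∧
    ∃ A : EuclideanSpace ℝ (Fin n) ≃ᵃ[ℝ] EuclideanSpace ℝ (Fin n),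
      MeasurePreserving A volume volume ∧
      IsIsotropicWith (A '' (K : Set (EuclideanSpace ℝ (Fin n)))) M}

/-- The isotropy constant `L_K = M_K / |K| ^ ((n + 2) / (2 n))`. -/
noncomputable def isotropyConstant {n : ℕ} (K : ConvexBody (EuclideanSpace ℝ (Fin n))) : ℝ :=
  isotropicMoment K /
    (volume.real (K : Set (EuclideanSpace ℝ (Fin n)))) ^ (((n : ℝ) + 2) / (2 * (n : ℝ)))

/-- `K` is symmetric with respect to the point `c`. -/
def IsSymmetricAbout {n : ℕ} (c : EuclideanSpace ℝ (Fin n))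
    (K : ConvexBody (EuclideanSpace ℝ (Fin n))) : Prop :=
  ∀ x ∈ K, (2 : ℝ) • c - x ∈ K

/-- `N` is an inner unit normal of `K` at the point `X₀`. -/
def IsInnerUnitNormal {n : ℕ} (K : ConvexBody (EuclideanSpace ℝ (Fin n)))
    (X₀ N : EuclideanSpace ℝ (Fin n)) : Prop :=
  ‖N‖ = 1 ∧ ∀ x ∈ K, 0 ≤ ⟪x - X₀, N⟫

/-- `K` has positive generalized (Gauss) curvature at its boundary point `X₀`: there are an inner
unit normal `N` of `K` at `X₀` and a positive definite quadratic form `q` on `N^⊥` such that near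
`X₀` the boundary points `X₀ + Y + y N` (`Y ⊥ N`, `y` real) of `K` satisfy
`(1 - ε) q(Y) ≤ y ≤ (1 + ε) q(Y)`. -/
def HasPositiveGeneralizedCurvatureAt {n : ℕ} (K : ConvexBody (EuclideanSpace ℝ (Fin n)))
    (X₀ : EuclideanSpace ℝ (Fin n)) : Prop :=
  X₀ ∈ frontier (K : Set (EuclideanSpace ℝ (Fin n))) ∧
  ∃ N : EuclideanSpace ℝ (Fin n), IsInnerUnitNormal K X₀ N ∧
    ∃ q : QuadraticForm ℝ (ℝ ∙ N)ᗮ, q.PosDef ∧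
      ∀ ε : ℝ, 0 < ε → ∃ a : ℝ, 0 < a ∧ ∀ (Y : (ℝ ∙ N)ᗮ) (y : ℝ),
        X₀ + (Y : EuclideanSpace ℝ (Fin n)) + y • N ∈
            frontier (K : Set (EuclideanSpace ℝ (Fin n))) ∩ Metric.closedBall X₀ a →
          (1 - ε) * q Y ≤ y ∧ y ≤ (1 + ε) * q Y

/-! A volume preserving affine map changes the inertia matrix C about the centroid g by congruence
with a matrix of determinant ±1. Hence `isotropyConstant K ^ (2 * n)` equals det C / V ^ (n + 2),
with V the volume. Its logarithm has as first variation the change of ∫ φ over the body, where φ(x)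
= ⟨C⁻¹(x - g), x - g⟩ - (n + 2)/V, and the error is quadratic in the volume δ of the symmetric
difference (`exists_isotropyConstant_lt_of_perturbation`). So near a local maximizer no admissible
perturbation raises ∫ φ by more than a constant times δ².

At a point X of positive curvature, blow up by the parabolic dilations T_s (factor s along the
tangent space, s² along the normal N). The body converges to the epigraph of a paraboloid w = B(u,
u), with u tangential and w normal (`IsOsculated.eventually_rescaled`), and a piece of bounded
rescaled size has volume O(s ^ (n + 1)). A gain of order s ^ (n + 3) therefore beats δ² = O(s ^ (2n
+ 2)), because n ≥ 2.

Two moves are available: cut a cap near any chosen point of the rescaled paraboloid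
(`IsOsculated.exists_cap`), or take the hull with X - s² N, which adds a region essentially below
the paraboloid (`IsOsculated.exists_spike`). Expanding φ(X + T_s z) in s shows that one of them
always gains (`hasNegativeCaps_or_hasPositiveSpikes`). If φ(X) ≠ 0, its sign decides. If φ(X) = 0
and the tangential gradient is non-zero, the linear term is negative somewhere on the paraboloid:
cut there. If the tangential gradient vanishes too, φ(X) = 0 and the position of g on the inner side
of the supporting hyperplane force a negative normal derivative 2β, and the leading term is
s²(⟨C⁻¹u, u⟩ + 2βw). Either it is negative at some point of the paraboloid, where one cuts, or it is
at least 2β(w - B(u, u)) everywhere, which is positive strictly below the paraboloid, and one adds a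
spike.

In the symmetric case φ is invariant under the reflection in c, and making the same move at X and at
2c - X doubles the gain and at most doubles the volume. -/

open Matrix in
/-- A symmetric real matrix is determined by its quadratic form. -/
lemma Matrix.eq_smul_one_of_dotProduct_mulVec {n : ℕ} {D : Matrix (Fin n) (Fin n) ℝ}
    (hD : D.IsHermitian) (a : ℝ) (h : ∀ y : Fin n → ℝ, y ⬝ᵥ D *ᵥ y = a * (y ⬝ᵥ y)) :
    D = a • (1 : Matrix (Fin n) (Fin n) ℝ) := by
  have hS : (D - a • (1 : Matrix (Fin n) (Fin n) ℝ)).IsHermitian :=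
    hD.sub (by ext i j; simp [Matrix.one_apply, eq_comm])
  have h0 := (Matrix.isSymmetric_toEuclideanLin_iff.mpr hS).inner_map_self_eq_zero.mp (by
    intro x
    have := h x.ofLp
    rw [Matrix.toLpLin_apply, EuclideanSpace.inner_eq_star_dotProduct]
    simp only [Matrix.sub_mulVec, Matrix.smul_mulVec, Matrix.one_mulVec, star_trivial,
      dotProduct_sub, dotProduct_smul, smul_eq_mul]
    linarith)
  exact sub_eq_zero.mp ((LinearEquiv.map_eq_zero_iff _).mp h0)

/-! ### Inertia matrices and the determinant formula for the isotropy constant. -/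

section Moments

variable {n : ℕ}

/-- The centroid of a set. -/
noncomputable def centroidOf (S : Set (EuclideanSpace ℝ (Fin n))) : EuclideanSpace ℝ (Fin n) :=
  (volume.real S)⁻¹ • ∫ x in S, x

/-- The matrix of second moments of a set about a point. -/
noncomputable def secondMoment (S : Set (EuclideanSpace ℝ (Fin n)))
    (a : EuclideanSpace ℝ (Fin n)) : Matrix (Fin n) (Fin n) ℝ :=
  Matrix.of fun i j => ∫ x in S, (x i - a i) * (x j - a j)

/-- The matrix of second moments of a set about its centroid. -/
noncomputable def inertia (S : Set (EuclideanSpace ℝ (Fin n))) : Matrix (Fin n) (Fin n) ℝ :=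
  secondMoment S (centroidOf S)

lemma secondMoment_isHermitian (S : Set (EuclideanSpace ℝ (Fin n)))
    (a : EuclideanSpace ℝ (Fin n)) : (secondMoment S a).IsHermitian := by
  ext i j
  simp [secondMoment, mul_comm]

lemma inner_eq_sum (x y : EuclideanSpace ℝ (Fin n)) : ⟪x, y⟫ = ∑ i, x i * y i := by
  simp [PiLp.inner_apply, mul_comm]

lemma setIntegral_inner_sub_sq {S : Set (EuclideanSpace ℝ (Fin n))} (hS : IsCompact S)
    (a y : EuclideanSpace ℝ (Fin n)) :
    ∫ x in S, ⟪x - a, y⟫ ^ 2 = y.ofLp ⬝ᵥ (secondMoment S a).mulVec y.ofLp := by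
  have hi : ∀ i j : Fin n, IntegrableOn
      (fun x : EuclideanSpace ℝ (Fin n) => y i * (((x i - a i) * (x j - a j)) * y j)) S := by
    intro i j
    exact (Continuous.continuousOn (by fun_prop)).integrableOn_compact hS
  have : ∀ x : EuclideanSpace ℝ (Fin n), ⟪x - a, y⟫ ^ 2 =
      ∑ i, ∑ j, y i * (((x i - a i) * (x j - a j)) * y j) := by
    intro x
    rw [inner_eq_sum, sq, Finset.sum_mul_sum]
    refine Finset.sum_congr rfl fun i _ => Finset.sum_congr rfl fun j _ => ?_
    simp only [PiLp.sub_apply]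
    ring
  simp_rw [this]
  rw [integral_finsetSum _ fun i _ => integrable_finsetSum _ fun j _ => hi i j]
  simp only [dotProduct, Matrix.mulVec, secondMoment, Matrix.of_apply, Finset.mul_sum]
  refine Finset.sum_congr rfl fun i _ => ?_
  rw [integral_finsetSum _ fun j _ => hi i j]
  refine Finset.sum_congr rfl fun j _ => ?_
  rw [integral_const_mul, integral_mul_const]

lemma measureReal_pos_of_interior {S : Set (EuclideanSpace ℝ (Fin n))} (hS : IsCompact S)
    (hi : (interior S).Nonempty) : 0 < volume.real S := by
  refine ENNReal.toReal_pos ?_ hS.measure_lt_top.ne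
  exact ((isOpen_interior.measure_pos volume hi).trans_le (measure_mono interior_subset)).ne'

lemma setIntegral_sub_centroidOf {S : Set (EuclideanSpace ℝ (Fin n))} (hS : IsCompact S)
    (hi : (interior S).Nonempty) : ∫ x in S, (x - centroidOf S) = 0 := by
  have hV := measureReal_pos_of_interior hS hi
  rw [integral_sub (f := fun x => x) (continuous_id.continuousOn.integrableOn_compact hS)
    (continuous_const.continuousOn.integrableOn_compact hS), setIntegral_const, centroidOf,
    smul_smul, mul_inv_cancel₀ hV.ne', one_smul, sub_self]

lemma setIntegral_inner_sub_centroidOf {S : Set (EuclideanSpace ℝ (Fin n))} (hS : IsCompact S)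
    (hi : (interior S).Nonempty) (y : EuclideanSpace ℝ (Fin n)) :
    ∫ x in S, ⟪x - centroidOf S, y⟫ = 0 := by
  have h := integral_inner (𝕜 := ℝ) (μ := volume.restrict S)
    (f := fun x => x - centroidOf S)
    ((Continuous.continuousOn (by fun_prop)).integrableOn_compact hS) y
  rw [setIntegral_sub_centroidOf hS hi, inner_zero_right] at h
  rw [← h]
  exact integral_congr_ae (.of_forall fun x => real_inner_comm _ _)

/-- A set with interior points lies in no hyperplane through its centroid, so no second moment about
it vanishes. -/
lemma inertia_posDef {S : Set (EuclideanSpace ℝ (Fin n))} (hS : IsCompact S)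
    (hi : (interior S).Nonempty) : (inertia S).PosDef := by
  rw [Matrix.posDef_iff_dotProduct_mulVec]
  refine ⟨secondMoment_isHermitian _ _, fun y hy => ?_⟩
  have := setIntegral_inner_sub_sq hS (centroidOf S) (WithLp.toLp 2 y)
  simp only [star_trivial, inertia] at this ⊢
  rw [← this, setIntegral_pos_iff_support_of_nonneg_ae (.of_forall fun x => sq_nonneg _)
    ((Continuous.continuousOn (by fun_prop)).integrableOn_compact hS)]
  set g := centroidOf S
  set Y : EuclideanSpace ℝ (Fin n) := WithLp.toLp 2 y
  have hY : Y ≠ 0 := fun h => hy (by simpa [Y] using h)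
  have ho : IsOpen ({x | ⟪x - g, Y⟫ ≠ 0} ∩ interior S) :=
    (isOpen_ne_fun (by fun_prop) continuous_const).inter isOpen_interior
  refine (ho.measure_pos volume ?_).trans_le (measure_mono ?_)
  · obtain ⟨x, hx⟩ := hi
    by_cases h0 : ⟪x - g, Y⟫ = 0
    · have hc : Filter.Tendsto (fun t : ℝ => x + t • Y) (nhdsWithin 0 {0}ᶜ) (nhds x) := by
        have : Continuous fun t : ℝ => x + t • Y := by fun_prop
        simpa using (this.tendsto 0).mono_left nhdsWithin_le_nhds
      obtain ⟨t, ht, ht0⟩ := ((hc.eventually (isOpen_interior.mem_nhds hx)).and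
        self_mem_nhdsWithin).exists
      refine ⟨x + t • Y, ?_, ht⟩
      have : ⟪x + t • Y - g, Y⟫ = t * ‖Y‖ ^ 2 := by
        rw [show x + t • Y - g = (x - g) + t • Y by abel, inner_add_left, h0, inner_smul_left,
          real_inner_self_eq_norm_sq]
        simp
      simp only [Set.mem_ofPred_eq, this]
      exact mul_ne_zero ht0 (by positivity)
    · exact ⟨x, h0, hx⟩
  · rintro x ⟨h1, h2⟩
    exact ⟨by simpa using h1, interior_subset h2⟩

lemma det_toEuclideanLin (W : Matrix (Fin n) (Fin n) ℝ) :
    LinearMap.det (Matrix.toEuclideanLin W) = W.det := by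
  rw [Matrix.toEuclideanLin, Matrix.toLpLin_eq_toLin]
  exact LinearMap.det_toLin _ _

lemma measurePreserving_toEuclideanLin_add {W : Matrix (Fin n) (Fin n) ℝ} (hW : |W.det| = 1)
    (b : EuclideanSpace ℝ (Fin n)) :
    MeasurePreserving (fun x => Matrix.toEuclideanLin W x + b) volume volume := by
  refine (measurePreserving_add_right volume b).comp ⟨?_, ?_⟩
  · exact (LinearMap.continuous_of_finiteDimensional _).measurable
  · have h0 : LinearMap.det (Matrix.toEuclideanLin W) ≠ 0 := by
      rw [det_toEuclideanLin]
      intro h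
      simp [h] at hW
    rw [Measure.map_linearMap_addHaar_eq_smul_addHaar _ h0, det_toEuclideanLin, abs_inv, hW]
    simp

/-- Compare the unit ball with its image. A singular W would have a null image whose preimage
contains the ball; otherwise the volumes differ by the factor |det W|. -/
lemma abs_det_of_measurePreserving {W : Matrix (Fin n) (Fin n) ℝ}
    {b : EuclideanSpace ℝ (Fin n)}
    (h : MeasurePreserving (fun x => Matrix.toEuclideanLin W x + b) volume volume) :
    |W.det| = 1 := by
  have h2 : MeasurePreserving (Matrix.toEuclideanLin W) volume volume := by
    have := (measurePreserving_add_right volume (-b)).comp h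
    simpa [Function.comp_def] using this
  have h3 := Measure.addHaar_image_linearMap volume (Matrix.toEuclideanLin W)
    (Metric.closedBall 0 1)
  have hc : IsCompact (Matrix.toEuclideanLin W ''
      (Metric.closedBall (0 : EuclideanSpace ℝ (Fin n)) 1)) :=
    (isCompact_closedBall _ _).image (LinearMap.continuous_of_finiteDimensional _)
  have h4 := h2.measure_preimage (s := Matrix.toEuclideanLin W ''
      (Metric.closedBall (0 : EuclideanSpace ℝ (Fin n)) 1)) hc.measurableSet.nullMeasurableSet
  have hinj : Function.Injective (Matrix.toEuclideanLin W) := by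
    by_contra hni
    have hker : LinearMap.ker (Matrix.toEuclideanLin W) ≠ ⊥ := by
      rwa [Ne, LinearMap.ker_eq_bot]
    have hd : LinearMap.det (Matrix.toEuclideanLin W) = 0 := by
      by_contra hd
      exact hker (LinearMap.ker_eq_bot.mpr (LinearMap.equivOfDetNeZero _ hd).injective)
    rw [hd] at h3
    rw [h3] at h4
    simp only [abs_zero, ENNReal.ofReal_zero, zero_mul] at h4
    have h5 : volume (Metric.closedBall (0 : EuclideanSpace ℝ (Fin n)) 1) ≤ 0 :=
      h4 ▸ measure_mono (Set.subset_preimage_image _ _)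
    exact absurd h5 (not_le.mpr (Metric.measure_closedBall_pos _ _ one_pos))
  rw [Set.preimage_image_eq _ hinj, h3, det_toEuclideanLin] at h4
  have hpos := Metric.measure_closedBall_pos volume (0 : EuclideanSpace ℝ (Fin n)) one_pos
  have hfin := (isCompact_closedBall (0 : EuclideanSpace ℝ (Fin n)) 1).measure_lt_top (μ := volume)
  have h6 := congrArg ENNReal.toReal h4
  rw [ENNReal.toReal_mul, ENNReal.toReal_ofReal (abs_nonneg _)] at h6
  have h7 := ENNReal.toReal_pos hpos.ne' hfin.ne
  nlinarith

/-- The map carries the centroid to d = W g + b and the inertia C to W C Wᵀ. Testing the first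
moments on y = d gives d = 0, and the quadratic form then determines the matrix. -/
lemma isIsotropicWith_image {S : Set (EuclideanSpace ℝ (Fin n))} (hS : IsCompact S)
    (hi : (interior S).Nonempty) {W : Matrix (Fin n) (Fin n) ℝ} (hW : |W.det| = 1)
    (b : EuclideanSpace ℝ (Fin n)) (M : ℝ) :
    IsIsotropicWith ((fun x => Matrix.toEuclideanLin W x + b) '' S) M ↔
      Matrix.toEuclideanLin W (centroidOf S) + b = 0 ∧
        W * inertia S * W.transpose = M ^ 2 • (1 : Matrix (Fin n) (Fin n) ℝ) := by
  set g := centroidOf S with hg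
  have hmp := measurePreserving_toEuclideanLin_add hW b
  have hWu : IsUnit W.det := by
    rw [isUnit_iff_ne_zero]; intro h; simp [h] at hW
  have hemb : MeasurableEmbedding (fun x => Matrix.toEuclideanLin W x + b) := by
    refine (Continuous.measurableEmbedding ?_ ?_)
    · exact (LinearMap.continuous_of_finiteDimensional _).add continuous_const
    · intro x y hxy
      have : Matrix.toEuclideanLin W (x - y) = 0 := by
        rw [map_sub, sub_eq_zero]; exact add_right_cancel hxy
      have h2 : LinearMap.ker (Matrix.toEuclideanLin W) = ⊥ := by
        have hd : LinearMap.det (Matrix.toEuclideanLin W) ≠ 0 := by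
          rw [det_toEuclideanLin]; exact hWu.ne_zero
        exact LinearMap.ker_eq_bot.mpr (LinearMap.equivOfDetNeZero _ hd).injective
      exact sub_eq_zero.mp (LinearMap.ker_eq_bot'.mp h2 _ this)
  have hadj : ∀ x y : EuclideanSpace ℝ (Fin n), ⟪Matrix.toEuclideanLin W x, y⟫ =
      ⟪x, Matrix.toEuclideanLin W.transpose y⟫ := by
    intro x y
    rw [Matrix.toLpLin_apply, Matrix.toLpLin_apply, EuclideanSpace.inner_eq_star_dotProduct,
      EuclideanSpace.inner_eq_star_dotProduct, star_trivial, star_trivial, Matrix.mulVec_transpose,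
      ← Matrix.dotProduct_mulVec]
  set d := Matrix.toEuclideanLin W g + b with hd
  have hexp : ∀ x y : EuclideanSpace ℝ (Fin n), ⟪Matrix.toEuclideanLin W x + b, y⟫ =
      ⟪x - g, Matrix.toEuclideanLin W.transpose y⟫ + ⟪d, y⟫ := by
    intro x y
    rw [← hadj, map_sub, ← inner_add_left, hd]
    congr 1
    abel
  have hV := measureReal_pos_of_interior hS hi
  have hfirst : ∀ y, ∫ x in (fun x => Matrix.toEuclideanLin W x + b) '' S, ⟪x, y⟫ =
      volume.real S * ⟪d, y⟫ := by
    intro y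
    rw [hmp.setIntegral_image_emb hemb]
    simp_rw [hexp]
    rw [integral_add ((Continuous.continuousOn (by fun_prop)).integrableOn_compact hS)
      ((Continuous.continuousOn (by fun_prop)).integrableOn_compact hS),
      setIntegral_inner_sub_centroidOf hS hi, setIntegral_const, smul_eq_mul, zero_add]
  have hsecond : d = 0 → ∀ y : EuclideanSpace ℝ (Fin n),
      ∫ x in (fun x => Matrix.toEuclideanLin W x + b) '' S, ⟪x, y⟫ ^ 2 =
      y.ofLp ⬝ᵥ (W * inertia S * W.transpose).mulVec y.ofLp := by
    intro h0 y
    rw [hmp.setIntegral_image_emb hemb]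
    simp_rw [hexp, h0, inner_zero_left, add_zero]
    rw [setIntegral_inner_sub_sq hS, Matrix.toLpLin_apply, ← inertia,
      ← Matrix.mulVec_mulVec, ← Matrix.mulVec_mulVec, Matrix.mulVec_transpose,
      Matrix.dotProduct_mulVec y.ofLp]
  have hnorm : ∀ y : EuclideanSpace ℝ (Fin n), ‖y‖ ^ 2 = y.ofLp ⬝ᵥ y.ofLp := by
    intro y
    rw [← real_inner_self_eq_norm_sq, EuclideanSpace.inner_eq_star_dotProduct, star_trivial]
  constructor
  · intro h
    have hd0 : d = 0 := by
      have := (h d).1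
      rw [hfirst, mul_eq_zero, or_iff_right hV.ne'] at this
      exact inner_self_eq_zero.mp this
    refine ⟨hd0, Matrix.eq_smul_one_of_dotProduct_mulVec ?_ _ fun y => ?_⟩
    · have := Matrix.isHermitian_mul_mul_conjTranspose W (secondMoment_isHermitian S g)
      simpa [inertia] using this
    · have := (h (WithLp.toLp 2 y)).2
      rw [hsecond hd0, hnorm] at this
      exact this
  · rintro ⟨hd0, hM⟩ y
    refine ⟨by rw [hfirst, hd0, inner_zero_left, mul_zero], ?_⟩
    rw [hsecond hd0, hM, hnorm, Matrix.smul_mulVec, Matrix.one_mulVec, dotProduct_smul,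
      smul_eq_mul]

lemma affineEquiv_eq_toEuclideanLin_add
    (A : EuclideanSpace ℝ (Fin n) ≃ᵃ[ℝ] EuclideanSpace ℝ (Fin n)) :
    (A : EuclideanSpace ℝ (Fin n) → EuclideanSpace ℝ (Fin n)) =
      fun x => Matrix.toEuclideanLin (Matrix.toEuclideanLin.symm (A.linear : _ →ₗ[ℝ] _)) x + A 0 := by
  funext x
  have := congrFun (AffineMap.decomp A.toAffineMap) x
  simpa using this

/-- Taking determinants removes W; this is why M does not depend on the normalizing map. -/
lemma moment_pow_eq_det {S : Set (EuclideanSpace ℝ (Fin n))} {W : Matrix (Fin n) (Fin n) ℝ}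
    (hW : |W.det| = 1) {M : ℝ}
    (h : W * inertia S * W.transpose = M ^ 2 • (1 : Matrix (Fin n) (Fin n) ℝ)) :
    M ^ (2 * n) = (inertia S).det := by
  have := congrArg Matrix.det h
  rw [Matrix.det_mul, Matrix.det_mul, Matrix.det_transpose, Matrix.det_smul, Matrix.det_one,
    mul_one, Fintype.card_fin, ← pow_mul] at this
  have h1 : W.det * W.det = 1 := by rw [← abs_mul_abs_self, hW, one_mul]
  rw [← this]
  linear_combination (inertia S).det * h1

-- Factor the inertia as Bᵀ B and take W = M (Bᵀ)⁻¹, which turns it into M² times the identity; M =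
-- |det B| ^ (1/n) is the value giving |det W| = 1.
open scoped MatrixOrder Matrix.Norms.L2Operator in
lemma exists_isotropic_image (hn : 2 ≤ n) {S : Set (EuclideanSpace ℝ (Fin n))} (hS : IsCompact S)
    (hi : (interior S).Nonempty) :
    ∃ M : ℝ, 0 < M ∧ ∃ A : EuclideanSpace ℝ (Fin n) ≃ᵃ[ℝ] EuclideanSpace ℝ (Fin n),
      MeasurePreserving A volume volume ∧ IsIsotropicWith (A '' S) M := by
  have hC := inertia_posDef hS hi
  obtain ⟨B, hB⟩ : ∃ B : Matrix (Fin n) (Fin n) ℝ, inertia S = B.transpose * B := by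
    obtain ⟨B, hB⟩ := CStarAlgebra.nonneg_iff_eq_star_mul_self.mp (Matrix.nonneg_iff_posSemidef.mpr hC.posSemidef)
    exact ⟨B, by simpa [Matrix.star_eq_conjTranspose] using hB⟩
  have hdet : (inertia S).det = B.det ^ 2 := by
    rw [hB, Matrix.det_mul, Matrix.det_transpose, sq]
  have hB0 : B.det ≠ 0 := by
    intro h
    have := hC.det_pos
    rw [hdet, h] at this
    simp at this
  set M : ℝ := |B.det| ^ ((n : ℝ)⁻¹) with hMdef
  have hMpos : 0 < M := Real.rpow_pos_of_pos (abs_pos.mpr hB0) _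
  have hMn : M ^ n = |B.det| := Real.rpow_inv_natCast_pow (abs_nonneg _) (by omega)
  set W : Matrix (Fin n) (Fin n) ℝ := M • (B.transpose)⁻¹ with hWdef
  have hBu : IsUnit B.det := hB0.isUnit
  have hBtu : IsUnit B.transpose.det := by rwa [Matrix.det_transpose]
  have hWdet : |W.det| = 1 := by
    rw [hWdef, Matrix.det_smul, Fintype.card_fin, Matrix.det_nonsing_inv, Matrix.det_transpose,
      hMn, abs_mul, abs_abs, Ring.inverse_eq_inv', abs_inv,
      mul_inv_cancel₀ (abs_pos.mpr hB0).ne']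
  have hWC : W * inertia S * W.transpose = M ^ 2 • (1 : Matrix (Fin n) (Fin n) ℝ) := by
    rw [hWdef, hB, Matrix.transpose_smul, Matrix.transpose_nonsing_inv, Matrix.transpose_transpose,
      Matrix.smul_mul, Matrix.smul_mul, Matrix.mul_smul, ← Matrix.mul_assoc,
      Matrix.nonsing_inv_mul _ hBtu, Matrix.one_mul, Matrix.mul_nonsing_inv _ hBu, smul_smul, sq]
  have hd : LinearMap.det (Matrix.toEuclideanLin W) ≠ 0 := by
    rw [det_toEuclideanLin]; intro h; simp [h] at hWdet
  set b := -Matrix.toEuclideanLin W (centroidOf S)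
  let A : EuclideanSpace ℝ (Fin n) ≃ᵃ[ℝ] EuclideanSpace ℝ (Fin n) :=
    (LinearMap.equivOfDetNeZero _ hd).toAffineEquiv.trans (AffineEquiv.constVAdd ℝ _ b)
  have hA : (A : EuclideanSpace ℝ (Fin n) → EuclideanSpace ℝ (Fin n)) =
      fun x => Matrix.toEuclideanLin W x + b := by
    funext x
    simp [A, LinearMap.equivOfDetNeZero, add_comm]
  refine ⟨M, hMpos, A, ?_, ?_⟩
  · rw [hA]
    exact measurePreserving_toEuclideanLin_add hWdet b
  · rw [hA, isIsotropicWith_image hS hi hWdet]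
    exact ⟨by simp [b], hWC⟩

lemma isotropicMoment_spec (hn : 2 ≤ n) {K : ConvexBody (EuclideanSpace ℝ (Fin n))}
    (hK : K ∈ properBodies n) :
    0 < isotropicMoment K ∧
      isotropicMoment K ^ (2 * n) = (inertia (K : Set (EuclideanSpace ℝ (Fin n)))).det := by
  have key : ∀ M : ℝ, (∃ A : EuclideanSpace ℝ (Fin n) ≃ᵃ[ℝ] EuclideanSpace ℝ (Fin n),
      MeasurePreserving A volume volume ∧
      IsIsotropicWith (A '' (K : Set (EuclideanSpace ℝ (Fin n)))) M) →
      M ^ (2 * n) = (inertia (K : Set (EuclideanSpace ℝ (Fin n)))).det := by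
    rintro M ⟨A, hA, hiso⟩
    rw [affineEquiv_eq_toEuclideanLin_add A] at hA hiso
    have hW := abs_det_of_measurePreserving hA
    exact moment_pow_eq_det hW ((isIsotropicWith_image K.isCompact hK hW _ _).mp hiso).2
  obtain ⟨M, hM0, hA⟩ := exists_isotropic_image hn K.isCompact hK
  have hset : {M : ℝ | 0 < M ∧ ∃ A : EuclideanSpace ℝ (Fin n) ≃ᵃ[ℝ] EuclideanSpace ℝ (Fin n),
      MeasurePreserving A volume volume ∧
      IsIsotropicWith (A '' (K : Set (EuclideanSpace ℝ (Fin n)))) M} = {M} := by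
    ext M'
    constructor
    · rintro ⟨h0, hA'⟩
      exact (pow_left_inj₀ h0.le hM0.le (by omega)).mp ((key _ hA').trans (key _ hA).symm)
    · rintro rfl
      exact ⟨hM0, hA⟩
  rw [isotropicMoment, hset, csSup_singleton]
  exact ⟨hM0, key _ hA⟩

lemma isotropyConstant_spec (hn : 2 ≤ n) {K : ConvexBody (EuclideanSpace ℝ (Fin n))}
    (hK : K ∈ properBodies n) :
    0 < isotropyConstant K ∧ isotropyConstant K ^ (2 * n) =
      (inertia (K : Set (EuclideanSpace ℝ (Fin n)))).det /
        volume.real (K : Set (EuclideanSpace ℝ (Fin n))) ^ (n + 2) := by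
  obtain ⟨h1, h2⟩ := isotropicMoment_spec hn hK
  have hV := measureReal_pos_of_interior K.isCompact hK
  refine ⟨div_pos h1 (Real.rpow_pos_of_pos hV _), ?_⟩
  rw [isotropyConstant, div_pow, h2, ← Real.rpow_natCast (_ ^ _) (2 * n), ← Real.rpow_mul hV.le,
    ← Real.rpow_natCast _ (n + 2)]
  congr 2
  have : (n : ℝ) ≠ 0 := by positivity
  push_cast
  field_simp

lemma isotropyConstant_lt (hn : 2 ≤ n) {K K' : ConvexBody (EuclideanSpace ℝ (Fin n))}
    (hK : K ∈ properBodies n) (hK' : K' ∈ properBodies n)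
    (h : (inertia (K : Set (EuclideanSpace ℝ (Fin n)))).det /
        volume.real (K : Set (EuclideanSpace ℝ (Fin n))) ^ (n + 2) <
      (inertia (K' : Set (EuclideanSpace ℝ (Fin n)))).det /
        volume.real (K' : Set (EuclideanSpace ℝ (Fin n))) ^ (n + 2)) :
    isotropyConstant K < isotropyConstant K' := by
  rw [← (isotropyConstant_spec hn hK).2, ← (isotropyConstant_spec hn hK').2] at h
  exact lt_of_pow_lt_pow_left₀ _ (isotropyConstant_spec hn hK').1.le h

end Moments

/-! ### First order expansions of products and determinants. -/

/-- Used for the diagonal product in a determinant near the identity and for the power n + 2 of the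
volume ratio; the constant depends on the index set only. -/
lemma abs_prod_one_add_sub_le {ι : Type*} (s : Finset ι) :
    ∃ c : ℝ, 0 ≤ c ∧ ∀ (a : ι → ℝ) (t : ℝ), 0 ≤ t → t ≤ 1 → (∀ i ∈ s, |a i| ≤ t) →
      |∏ i ∈ s, (1 + a i) - 1 - ∑ i ∈ s, a i| ≤ c * t ^ 2 := by
  classical
  induction s using Finset.induction_on with
  | empty => exact ⟨0, le_rfl, fun a t _ _ _ => by simp⟩
  | insert j s hj ih =>
    obtain ⟨c, hc, ih⟩ := ih
    refine ⟨2 * c + s.card, by positivity, fun a t ht0 ht1 ha => ?_⟩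
    have h1 := ih a t ht0 ht1 fun i hi => ha i (Finset.mem_insert_of_mem hi)
    have h2 := ha j (Finset.mem_insert_self _ _)
    have h3 : |∑ i ∈ s, a i| ≤ s.card * t := by
      refine (Finset.abs_sum_le_sum_abs _ _).trans ?_
      rw [← nsmul_eq_mul]
      exact Finset.sum_le_card_nsmul _ _ _ fun i hi => ha i (Finset.mem_insert_of_mem hi)
    rw [Finset.prod_insert hj, Finset.sum_insert hj]
    set P := ∏ i ∈ s, (1 + a i)
    set σs := ∑ i ∈ s, a i
    have e : (1 + a j) * P - 1 - (a j + σs) = (P - 1 - σs) + a j * ((P - 1 - σs) + σs) := by ring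
    have h4 : |a j * ((P - 1 - σs) + σs)| ≤ t * (c * t ^ 2 + s.card * t) := by
      rw [abs_mul]
      exact mul_le_mul h2 ((abs_add_le _ _).trans (add_le_add h1 h3)) (abs_nonneg _) ht0
    rw [e]
    refine (abs_add_le _ _).trans ((add_le_add h1 h4).trans ?_)
    have : c * t ^ 2 * t ≤ c * t ^ 2 * 1 := mul_le_mul_of_nonneg_left ht1 (by positivity)
    nlinarith

/-- First order expansion of the determinant at the identity. -/
lemma Matrix.le_det_one_add (n : ℕ) :
    ∃ c : ℝ, 0 ≤ c ∧ ∀ (A : Matrix (Fin n) (Fin n) ℝ) (t : ℝ), 0 ≤ t → t ≤ 1 →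
      (∀ i j, |A i j| ≤ t) → 1 + A.trace - c * t ^ 2 ≤ (1 + A).det := by
  classical
  obtain ⟨c, hc, hprod⟩ := abs_prod_one_add_sub_le (Finset.univ : Finset (Fin n))
  refine ⟨c + (Finset.univ.erase (1 : Equiv.Perm (Fin n))).card * 2 ^ n, by positivity,
    fun A t ht0 ht1 hA => ?_⟩
  rw [Matrix.det_apply, ← Finset.add_sum_erase _ _ (Finset.mem_univ (1 : Equiv.Perm (Fin n)))]
  have h1 := (abs_le.mp (hprod (fun i => A i i) t ht0 ht1 fun i _ => hA i i)).1
  have h2 : |∑ σ ∈ Finset.univ.erase (1 : Equiv.Perm (Fin n)),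
      Equiv.Perm.sign σ • ∏ i, (1 + A) (σ i) i| ≤
      (Finset.univ.erase (1 : Equiv.Perm (Fin n))).card * (2 ^ n * t ^ 2) := by
    refine (Finset.abs_sum_le_sum_abs _ _).trans ?_
    rw [← nsmul_eq_mul]
    refine Finset.sum_le_card_nsmul _ _ _ fun σ hσ => ?_
    have hσ1 : σ ≠ 1 := (Finset.mem_erase.mp hσ).1
    -- σ moves both i and σ i, so at least two factors are off-diagonal and at most t: the whole
    -- term is of second order.
    obtain ⟨i, hi⟩ : ∃ i, σ i ≠ i := by
      by_contra! h
      exact hσ1 (Equiv.ext h)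
    have hj : σ (σ i) ≠ σ i := fun h => hi (σ.injective h)
    have hs : |(Equiv.Perm.sign σ • ∏ i, (1 + A) (σ i) i : ℝ)| = |∏ i, (1 + A) (σ i) i| := by
      rcases Int.units_eq_one_or (Equiv.Perm.sign σ) with h | h <;> simp [h]
    rw [hs, Finset.abs_prod]
    have hbd : ∀ k, |(1 + A) (σ k) k| ≤
        ((if k = i then t else 1) * (if k = σ i then t else 1)) * 2 := by
      intro k
      have hA' := hA (σ k) k
      have hle : |(1 + A) (σ k) k| ≤ 2 := by
        rw [Matrix.add_apply, Matrix.one_apply]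
        refine (abs_add_le _ _).trans ?_
        split_ifs <;> simp <;> linarith
      have hoff : σ k ≠ k → |(1 + A) (σ k) k| ≤ t := by
        intro h
        rwa [Matrix.add_apply, Matrix.one_apply_ne h, zero_add]
      by_cases h1 : k = i
      · subst h1
        simp only [if_true, if_neg hi.symm]
        linarith [hoff hi]
      · by_cases h2 : k = σ i
        · subst h2
          simp only [if_neg h1, if_true]
          linarith [hoff hj]
        · simpa [h1, h2] using hle
    refine (Finset.prod_le_prod (fun k _ => abs_nonneg _) fun k _ => hbd k).trans ?_
    rw [Finset.prod_mul_distrib, Finset.prod_mul_distrib, Finset.prod_ite_eq' , Finset.prod_ite_eq']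
    simp
    apply le_of_eq; ring
  have h3 := (abs_le.mp h2).1
  simp only [Equiv.Perm.sign_one, one_smul, Equiv.Perm.one_apply, Matrix.add_apply,
    Matrix.one_apply_eq] at h1 h3 ⊢
  rw [Matrix.trace]
  simp only [Matrix.diag_apply]
  nlinarith

/-! ### First variation of the isotropy constant. -/

section Perturbation

variable {n : ℕ}

lemma abs_setIntegral_sub_le {S S' : Set (EuclideanSpace ℝ (Fin n))} (hS : IsCompact S)
    (hS' : IsCompact S') {f : EuclideanSpace ℝ (Fin n) → ℝ} (hf : Continuous f) {B : ℝ}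
    (hB : ∀ x ∈ S ∪ S', |f x| ≤ B) :
    |(∫ x in S', f x) - ∫ x in S, f x| ≤ B * (volume.real (S \ S') + volume.real (S' \ S)) := by
  have h1 := integral_inter_add_sdiff (μ := volume) (s := S) (t := S') hS'.measurableSet
    (hf.continuousOn.integrableOn_compact hS)
  have h2 := integral_inter_add_sdiff (μ := volume) (s := S') (t := S) hS.measurableSet
    (hf.continuousOn.integrableOn_compact hS')
  rw [Set.inter_comm] at h2
  have h3 := norm_setIntegral_le_of_norm_le_const (μ := volume) (s := S \ S') (f := f) (C := B)
    ((measure_mono Set.sdiff_subset).trans_lt hS.measure_lt_top)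
    fun x hx => hB x (Or.inl hx.1)
  have h4 := norm_setIntegral_le_of_norm_le_const (μ := volume) (s := S' \ S) (f := f) (C := B)
    ((measure_mono Set.sdiff_subset).trans_lt hS'.measure_lt_top)
    fun x hx => hB x (Or.inr hx.1)
  rw [Real.norm_eq_abs] at h3 h4
  rw [← h1, ← h2, add_sub_add_left_eq_sub, sub_eq_add_neg, mul_add, add_comm]
  refine (abs_add_le _ _).trans ?_
  rw [abs_neg]
  exact add_le_add h3 h4

/-- The function whose integral is the first variation of the logarithm of
`det (inertia S) / |S| ^ (n + 2)`. -/
noncomputable def firstVariation (S : Set (EuclideanSpace ℝ (Fin n)))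
    (x : EuclideanSpace ℝ (Fin n)) : ℝ :=
  ⟪Matrix.toEuclideanLin (inertia S)⁻¹ (x - centroidOf S), x - centroidOf S⟫ -
    ((n : ℝ) + 2) / volume.real S

lemma firstVariation_continuous (S : Set (EuclideanSpace ℝ (Fin n))) :
    Continuous (firstVariation S) := by
  have : Continuous (Matrix.toEuclideanLin (inertia S)⁻¹) :=
    LinearMap.continuous_of_finiteDimensional _
  unfold firstVariation
  fun_prop

/-- Rewrites the integral of the first variation as a trace, the form in which it appears in the
expansion of the determinant. -/
lemma setIntegral_inner_toEuclideanLin {T : Set (EuclideanSpace ℝ (Fin n))} (hT : IsCompact T)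
    (P : Matrix (Fin n) (Fin n) ℝ) (a : EuclideanSpace ℝ (Fin n)) :
    ∫ x in T, ⟪Matrix.toEuclideanLin P (x - a), x - a⟫ = (P * secondMoment T a).trace := by
  have hi : ∀ i j : Fin n, IntegrableOn
      (fun x : EuclideanSpace ℝ (Fin n) => P i j * ((x j - a j) * (x i - a i))) T := by
    intro i j
    exact (Continuous.continuousOn (by fun_prop)).integrableOn_compact hT
  have : ∀ x : EuclideanSpace ℝ (Fin n), ⟪Matrix.toEuclideanLin P (x - a), x - a⟫ =
      ∑ i, ∑ j, P i j * ((x j - a j) * (x i - a i)) := by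
    intro x
    rw [inner_eq_sum]
    refine Finset.sum_congr rfl fun i _ => ?_
    rw [Matrix.toLpLin_apply]
    simp only [Matrix.mulVec, dotProduct, Finset.sum_mul, PiLp.sub_apply, mul_assoc]
  simp_rw [this]
  rw [integral_finsetSum _ fun i _ => integrable_finsetSum _ fun j _ => hi i j, Matrix.trace]
  refine Finset.sum_congr rfl fun i _ => ?_
  rw [integral_finsetSum _ fun j _ => hi i j, Matrix.diag_apply, Matrix.mul_apply]
  refine Finset.sum_congr rfl fun j _ => ?_
  rw [integral_const_mul]
  rfl

/-- The parallel axis theorem. It lets the moments of a perturbed body be taken about the centroid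
of the original one. -/
lemma inertia_apply_eq {T : Set (EuclideanSpace ℝ (Fin n))} (hT : IsCompact T)
    (hi : (interior T).Nonempty) (a : EuclideanSpace ℝ (Fin n)) (i j : Fin n) :
    inertia T i j = secondMoment T a i j -
      (volume.real T)⁻¹ * ((∫ x in T, (x i - a i)) * ∫ x in T, (x j - a j)) := by
  have hV := measureReal_pos_of_interior hT hi
  have hint : ∀ f : EuclideanSpace ℝ (Fin n) → ℝ, Continuous f → IntegrableOn f T := fun f hf =>
    hf.continuousOn.integrableOn_compact hT
  set g := centroidOf T with hg
  have hz : ∀ k, ∫ x in T, (x k - g k) = 0 := by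
    intro k
    have := setIntegral_inner_sub_centroidOf hT hi (EuclideanSpace.single k 1)
    simpa [inner_eq_sum] using this
  have hm : ∀ k, ∫ x in T, (x k - a k) = volume.real T * (g k - a k) := by
    intro k
    have e : (fun x : EuclideanSpace ℝ (Fin n) => x k - a k) =
        fun x => (x k - g k) + (g k - a k) := by
      funext x; ring
    rw [e]
    rw [integral_add (hint _ (by fun_prop)) (hint _ (by fun_prop)), hz, setIntegral_const,
      smul_eq_mul, zero_add]
  have hs : secondMoment T a i j = inertia T i j +
      volume.real T * ((g i - a i) * (g j - a j)) := by
    simp only [secondMoment, inertia, Matrix.of_apply]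
    have e : (fun x : EuclideanSpace ℝ (Fin n) => (x i - a i) * (x j - a j)) = fun x =>
        ((x i - g i) * (x j - g j) + ((g j - a j) * (x i - g i) + (g i - a i) * (x j - g j))) +
          (g i - a i) * (g j - a j) := by
      funext x; ring
    rw [e]
    rw [integral_add (hint _ (by fun_prop)) (hint _ (by fun_prop)),
      integral_add (hint _ (by fun_prop)) (hint _ (by fun_prop)),
      integral_add (hint _ (by fun_prop)) (hint _ (by fun_prop)),
      integral_const_mul, integral_const_mul, hz, hz, setIntegral_const, smul_eq_mul]
    ring
  rw [hs, hm, hm]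
  field_simp
  ring

set_option maxHeartbeats 1000000 in
/-- A perturbation of a convex body which increases the integral of the first variation by more
than a multiple of the square of its volume increases the isotropy constant. -/
lemma exists_isotropyConstant_lt_of_perturbation (hn : 2 ≤ n)
    {K : ConvexBody (EuclideanSpace ℝ (Fin n))} (hK : K ∈ properBodies n) (R : ℝ) :
    ∃ c δ₀ : ℝ, 0 < c ∧ 0 < δ₀ ∧ ∀ K' ∈ properBodies n,
      (∀ x ∈ K', ‖x - centroidOf (K : Set (EuclideanSpace ℝ (Fin n)))‖ ≤ R) → ∀ δ : ℝ,
      volume.real ((K : Set (EuclideanSpace ℝ (Fin n))) \ K') +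
        volume.real ((K' : Set (EuclideanSpace ℝ (Fin n))) \ K) ≤ δ → δ ≤ δ₀ →
      c * δ ^ 2 < (∫ x in (K' : Set (EuclideanSpace ℝ (Fin n))), firstVariation K x) -
        (∫ x in (K : Set (EuclideanSpace ℝ (Fin n))), firstVariation K x) →
      isotropyConstant K < isotropyConstant K' := by
  set S := (K : Set (EuclideanSpace ℝ (Fin n))) with hSdef
  have hS : IsCompact S := K.isCompact
  have hSi : (interior S).Nonempty := hK
  set g := centroidOf S with hg
  set V := volume.real S with hVdef
  have hV : 0 < V := measureReal_pos_of_interior hS hSi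
  set C := inertia S with hC
  have hCpos := inertia_posDef hS hSi
  have hCdet : 0 < C.det := hCpos.det_pos
  obtain ⟨R₁, hR₁1, hR₁R, hR₁⟩ : ∃ R₁ : ℝ, 1 ≤ R₁ ∧ R ≤ R₁ ∧ ∀ x ∈ S, ‖x - g‖ ≤ R₁ := by
    obtain ⟨r, hr⟩ := (hS.image (f := fun x => x - g) (by fun_prop)).isBounded.exists_norm_le
    exact ⟨max 1 (max R r), le_max_left _ _, (le_max_left _ _).trans (le_max_right _ _),
      fun x hx => (hr _ ⟨x, hx, rfl⟩).trans ((le_max_right _ _).trans (le_max_right _ _))⟩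
  obtain ⟨c₁, hc₁, hdet⟩ := Matrix.le_det_one_add n
  obtain ⟨c₂, hc₂, hprod⟩ := abs_prod_one_add_sub_le (Finset.range (n + 2))
  set p := ∑ i, ∑ j, |C⁻¹ i j| with hp
  have hp0 : 0 ≤ p := Finset.sum_nonneg fun i _ => Finset.sum_nonneg fun j _ => abs_nonneg _
  have hpij : ∀ i j, |C⁻¹ i j| ≤ p := fun i j =>
    (Finset.single_le_sum (f := fun j => |C⁻¹ i j|) (fun j _ => abs_nonneg _)
      (Finset.mem_univ j)).trans
      (Finset.single_le_sum (f := fun i => ∑ j, |C⁻¹ i j|)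
        (fun i _ => Finset.sum_nonneg fun j _ => abs_nonneg _) (Finset.mem_univ i))
  set b := R₁ ^ 2 + 2 / V * R₁ ^ 2 with hb
  have hb0 : 0 < b := by positivity
  set a := n * (p * b) with ha
  have ha0 : 0 ≤ a := by positivity
  have hn0 : (0 : ℝ) < n := by positivity
  -- The second order errors of the determinant, of the volume power and of the centroid shift, in
  -- this order; the 1 makes c positive.
  set c := c₁ * a ^ 2 + c₂ / V ^ 2 + n * (n * (p * (2 / V * R₁ ^ 2))) + 1 with hcdef
  -- The three bounds on δ give δ² ≤ δ, V' ≥ V / 2 and a δ ≤ 1, the last being the range of the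
  -- determinant expansion.
  refine ⟨c, min 1 (min (V / 2) (a + 1)⁻¹), by positivity, by positivity, ?_⟩
  intro K' hK' hK'R δ hδ hδ₀ hgain
  set S' := (K' : Set (EuclideanSpace ℝ (Fin n))) with hS'def
  have hS' : IsCompact S' := K'.isCompact
  have hS'i : (interior S').Nonempty := hK'
  have hδ1 : δ ≤ 1 := hδ₀.trans (min_le_left _ _)
  have hδV : δ ≤ V / 2 := hδ₀.trans ((min_le_right _ _).trans (min_le_left _ _))
  have hδa : δ ≤ (a + 1)⁻¹ := hδ₀.trans ((min_le_right _ _).trans (min_le_right _ _))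
  have hδ0 : 0 ≤ δ := (add_nonneg measureReal_nonneg measureReal_nonneg).trans hδ
  have haδ : a * δ ≤ 1 := by
    have : (a + 1) * δ ≤ 1 := by
      calc (a + 1) * δ ≤ (a + 1) * (a + 1)⁻¹ := mul_le_mul_of_nonneg_left hδa (by linarith)
        _ = 1 := mul_inv_cancel₀ (by linarith)
    nlinarith
  have hnorm : ∀ x ∈ S ∪ S', ‖x - g‖ ≤ R₁ := by
    rintro x (hx | hx)
    · exact hR₁ x hx
    · exact (hK'R x hx).trans hR₁R
  have hcoord : ∀ x ∈ S ∪ S', ∀ i, |x i - g i| ≤ R₁ := fun x hx i =>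
    (PiLp.norm_apply_le (x - g) i).trans (hnorm x hx)
  set V' := volume.real S' with hV'def
  have hdiff : ∀ f : EuclideanSpace ℝ (Fin n) → ℝ, Continuous f → ∀ B, 0 ≤ B →
      (∀ x ∈ S ∪ S', |f x| ≤ B) → |(∫ x in S', f x) - ∫ x in S, f x| ≤ B * δ :=
    fun f hf B hB0 hB => (abs_setIntegral_sub_le hS hS' hf hB).trans
      (mul_le_mul_of_nonneg_left hδ hB0)
  have hVV' : |V' - V| ≤ δ := by
    have := hdiff (fun _ => 1) continuous_const 1 zero_le_one (by simp)
    simpa using this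
  have hV'2 : V / 2 ≤ V' := by linarith [(abs_le.mp hVV').1]
  have hV'0 : 0 < V' := by linarith
  have hV'inv : V'⁻¹ ≤ 2 / V := by
    rw [inv_le_comm₀ hV'0 (by positivity), inv_div]; exact hV'2
  set m : Fin n → ℝ := fun i => ∫ x in S', (x i - g i) with hm
  have hmle : ∀ i, |m i| ≤ R₁ * δ := by
    intro i
    have := hdiff (fun x => x i - g i) (by fun_prop) R₁ (by linarith) fun x hx => hcoord x hx i
    have h0 : ∫ x in S, (x i - g i) = 0 := by
      have := setIntegral_inner_sub_centroidOf hS hSi (EuclideanSpace.single i 1)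
      simpa [inner_eq_sum] using this
    rwa [h0, sub_zero] at this
  set D := secondMoment S' g - C with hD
  -- E is quadratic in δ: g is the centroid of K, so the first moments m of K' about g are O(δ).
  set E : Matrix (Fin n) (Fin n) ℝ := Matrix.of fun i j => V'⁻¹ * (m i * m j) with hE
  have hC' : inertia S' = C + (D - E) := by
    ext i j
    rw [inertia_apply_eq hS' hS'i g i j]
    simp only [D, E, m, V', Matrix.add_apply, Matrix.sub_apply, Matrix.of_apply]
    ring
  have hDle : ∀ i j, |D i j| ≤ R₁ ^ 2 * δ := by
    intro i j
    refine hdiff (fun x => (x i - g i) * (x j - g j)) (by fun_prop) (R₁ ^ 2) (by positivity)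
      fun x hx => ?_
    rw [abs_mul, sq]
    exact mul_le_mul (hcoord x hx i) (hcoord x hx j) (abs_nonneg _) (by linarith)
  have hEle : ∀ i j, |E i j| ≤ 2 / V * R₁ ^ 2 * δ ^ 2 := by
    intro i j
    simp only [E, Matrix.of_apply]
    rw [abs_mul, abs_mul, abs_of_pos (inv_pos.mpr hV'0)]
    calc V'⁻¹ * (|m i| * |m j|) ≤ 2 / V * ((R₁ * δ) * (R₁ * δ)) :=
          mul_le_mul hV'inv (mul_le_mul (hmle i) (hmle j) (abs_nonneg _) (by positivity))
            (by positivity) (by positivity)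
      _ = _ := by ring
  have hDE : ∀ i j, |(D - E) i j| ≤ b * δ := by
    intro i j
    have hsq : δ ^ 2 ≤ δ := by nlinarith
    have hq : 2 / V * R₁ ^ 2 * δ ^ 2 ≤ 2 / V * R₁ ^ 2 * δ :=
      mul_le_mul_of_nonneg_left hsq (by positivity)
    rw [Matrix.sub_apply]
    refine (abs_sub _ _).trans ((add_le_add (hDle i j) (hEle i j)).trans ?_)
    rw [hb]; linarith
  have hmulbd : ∀ (F : Matrix (Fin n) (Fin n) ℝ) (B : ℝ), 0 ≤ B → (∀ i j, |F i j| ≤ B) →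
      ∀ i j, |(C⁻¹ * F) i j| ≤ n * (p * B) := by
    intro F B hB hF i j
    rw [Matrix.mul_apply]
    refine (Finset.abs_sum_le_sum_abs _ _).trans ?_
    have := Finset.sum_le_card_nsmul (Finset.univ : Finset (Fin n))
      (fun k => |C⁻¹ i k * F k j|) (p * B) fun k _ => by
        rw [abs_mul]
        exact mul_le_mul (hpij i k) (hF k j) (abs_nonneg _) hp0
    simpa using this
  have hAle : ∀ i j, |(C⁻¹ * (D - E)) i j| ≤ a * δ := by
    intro i j
    have := hmulbd (D - E) (b * δ) (by positivity) hDE i j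
    rw [ha]
    linarith
  have hlow := hdet _ (a * δ) (by positivity) haδ hAle
  have hCu : IsUnit C.det := hCdet.ne'.isUnit
  have hdetC' : (inertia S').det = C.det * (1 + C⁻¹ * (D - E)).det := by
    rw [← Matrix.det_mul, Matrix.mul_add, Matrix.mul_one, Matrix.mul_nonsing_inv_cancel_left _ _ hCu,
      hC']
  have htrE : |(C⁻¹ * E).trace| ≤ n * (n * (p * (2 / V * R₁ ^ 2))) * δ ^ 2 := by
    rw [Matrix.trace]
    refine (Finset.abs_sum_le_sum_abs _ _).trans ?_
    have := Finset.sum_le_card_nsmul (Finset.univ : Finset (Fin n))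
      (fun i => |(C⁻¹ * E) i i|) (n * (p * (2 / V * R₁ ^ 2 * δ ^ 2))) fun i _ =>
        hmulbd E _ (by positivity) hEle i i
    simp only [Finset.card_univ, Fintype.card_fin, nsmul_eq_mul] at this
    simp only [Matrix.diag_apply]
    linarith
  have hphi : ∀ T : Set (EuclideanSpace ℝ (Fin n)), IsCompact T →
      ∫ x in T, firstVariation S x =
        (C⁻¹ * secondMoment T g).trace - ((n : ℝ) + 2) / V * volume.real T := by
    intro T hT
    have hcont : Continuous (Matrix.toEuclideanLin (C⁻¹)) :=
      LinearMap.continuous_of_finiteDimensional _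
    simp only [firstVariation]
    rw [integral_sub ((Continuous.continuousOn (by fun_prop)).integrableOn_compact hT)
      ((Continuous.continuousOn (by fun_prop)).integrableOn_compact hT),
      setIntegral_inner_toEuclideanLin hT, setIntegral_const, smul_eq_mul, mul_comm (volume.real T)]
  rw [hphi S' hS', hphi S hS] at hgain
  have htr : (C⁻¹ * (D - E)).trace = (C⁻¹ * secondMoment S' g).trace -
      (C⁻¹ * secondMoment S g).trace - (C⁻¹ * E).trace := by
    rw [hD, Matrix.mul_sub, Matrix.mul_sub, Matrix.trace_sub, Matrix.trace_sub]
    rfl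
  set τ := (V' - V) / V with hτ
  have hτle : |τ| ≤ δ / V := by
    rw [hτ, abs_div, abs_of_pos hV]
    exact div_le_div_of_nonneg_right hVV' hV.le
  have hpow : (1 + τ) ^ (n + 2) ≤ 1 + ((n : ℝ) + 2) * τ + c₂ * (δ / V) ^ 2 := by
    have h1 : δ / V ≤ 1 := by rw [div_le_one hV]; linarith
    have := (abs_le.mp (hprod (fun _ => τ) (δ / V) (by positivity) h1 fun _ _ => hτle)).2
    simp only [Finset.prod_const, Finset.card_range, Finset.sum_const, nsmul_eq_mul] at this
    push_cast at this
    linarith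
  -- To first order the two sides differ by tr(C⁻¹ D) - (n + 2) τ, which is exactly the gain in ∫ φ.
  have hkey : (1 + τ) ^ (n + 2) < (1 + C⁻¹ * (D - E)).det := by
    refine hpow.trans_lt (lt_of_lt_of_le ?_ hlow)
    rw [htr]
    have h1 := (abs_le.mp htrE).2
    have h2 : ((n : ℝ) + 2) * τ = ((n : ℝ) + 2) / V * V' - ((n : ℝ) + 2) / V * V := by
      rw [hτ]; ring
    have h3 : c * δ ^ 2 = c₁ * (a * δ) ^ 2 + c₂ * (δ / V) ^ 2 +
        n * (n * (p * (2 / V * R₁ ^ 2))) * δ ^ 2 + δ ^ 2 := by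
      rw [hcdef]; ring
    have h4 := sq_nonneg δ
    linarith
  refine isotropyConstant_lt hn hK hK' ?_
  change C.det / V ^ (n + 2) < (inertia S').det / V' ^ (n + 2)
  have hVτ : V' = V * (1 + τ) := by rw [hτ]; field_simp; ring
  rw [div_lt_div_iff₀ (by positivity) (by positivity), hdetC', hVτ, mul_pow]
  have : 0 < C.det * V ^ (n + 2) := by positivity
  calc C.det * (V ^ (n + 2) * (1 + τ) ^ (n + 2)) = C.det * V ^ (n + 2) * (1 + τ) ^ (n + 2) := by ring
    _ < C.det * V ^ (n + 2) * (1 + C⁻¹ * (D - E)).det := mul_lt_mul_of_pos_left hkey this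
    _ = _ := by ring

end Perturbation

/-! ### Parabolic blow-up at a point of positive curvature. -/

section LocalGeometry

variable {E : Type*} [NormedAddCommGroup E] [InnerProductSpace ℝ E]

/-- `B` is a symmetric form with radical spanned by the unit vector `N`, positive definite on the
orthogonal complement of `N`. -/
structure IsTransverseForm (N : E) (B : E →L[ℝ] E →L[ℝ] ℝ) : Prop where
  norm_eq : ‖N‖ = 1
  symm : ∀ x y, B x y = B y x
  apply_normal : ∀ x, B x N = 0
  pos : ∀ x, ⟪x, N⟫ = 0 → x ≠ 0 → 0 < B x x

/-- The vertical distance above the paraboloid of the form `B`. -/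
noncomputable def heightAbove (N : E) (B : E →L[ℝ] E →L[ℝ] ℝ) (z : E) : ℝ := ⟪z, N⟫ - B z z

/-- The parabolic dilation: `s` on the orthogonal complement of `N` and `s ^ 2` on `N`. -/
noncomputable def parabolicDilation (N : E) (s : ℝ) : E →L[ℝ] E :=
  s • ContinuousLinearMap.id ℝ E + (s ^ 2 - s) • (innerSL ℝ N).smulRight N

lemma parabolicDilation_apply (N : E) (s : ℝ) (z : E) :
    parabolicDilation N s z = s • z + ((s ^ 2 - s) * ⟪z, N⟫) • N := by
  simp [parabolicDilation, smul_smul, real_inner_comm]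

namespace IsTransverseForm

variable {N : E} {B : E →L[ℝ] E →L[ℝ] ℝ} (h : IsTransverseForm N B)
include h

lemma inner_self : ⟪N, N⟫ = 1 := by
  rw [real_inner_self_eq_norm_sq, h.norm_eq, one_pow]

lemma apply_normal_left (x : E) : B N x = 0 := by rw [h.symm, h.apply_normal]

lemma apply_add_smul (x : E) (t : ℝ) : B (x + t • N) (x + t • N) = B x x := by
  simp [h.apply_normal, h.apply_normal_left]

lemma inner_add_smul (x : E) (t : ℝ) : ⟪x + t • N, N⟫ = ⟪x, N⟫ + t := by
  rw [inner_add_left, inner_smul_left, h.inner_self]; simp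

lemma heightAbove_add_smul (x : E) (t : ℝ) :
    heightAbove N B (x + t • N) = heightAbove N B x + t := by
  rw [heightAbove, heightAbove, h.apply_add_smul, h.inner_add_smul]; ring

lemma pos_of_sub_ne_zero (x : E) (hx : x - ⟪x, N⟫ • N ≠ 0) : 0 < B x x := by
  have := h.pos (x - ⟪x, N⟫ • N)
    (by rw [inner_sub_left, inner_smul_left, h.inner_self]; simp) hx
  rwa [sub_eq_add_neg, ← neg_smul, h.apply_add_smul] at this

lemma nonneg (x : E) : 0 ≤ B x x := by
  by_cases hx : x - ⟪x, N⟫ • N = 0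
  · rw [sub_eq_zero] at hx
    rw [hx]
    simp [h.apply_normal]
  · exact (h.pos_of_sub_ne_zero x hx).le

lemma eq_of_apply_self_eq_zero {x : E} (hx : B x x = 0) : x = ⟪x, N⟫ • N := by
  by_contra hne
  exact (h.pos_of_sub_ne_zero x (sub_ne_zero.mpr hne)).ne' hx

lemma inner_parabolicDilation (s : ℝ) (z : E) : ⟪parabolicDilation N s z, N⟫ = s ^ 2 * ⟪z, N⟫ := by
  rw [parabolicDilation_apply, h.inner_add_smul, inner_smul_left]; simp; ring

lemma form_parabolicDilation (s : ℝ) (z : E) :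
    B (parabolicDilation N s z) (parabolicDilation N s z) = s ^ 2 * B z z := by
  rw [parabolicDilation_apply, h.apply_add_smul]; simp; ring

lemma parabolicDilation_comp (s t : ℝ) (z : E) :
    parabolicDilation N s (parabolicDilation N t z) = parabolicDilation N (s * t) z := by
  rw [parabolicDilation_apply _ s, h.inner_parabolicDilation, parabolicDilation_apply,
    parabolicDilation_apply, smul_add, smul_smul, smul_smul, add_assoc, ← add_smul]
  congr 2
  ring

omit h in
lemma parabolicDilation_one (z : E) : parabolicDilation N 1 z = z := by
  rw [parabolicDilation_apply]; simp

lemma parabolicDilation_inv_right {s : ℝ} (hs : s ≠ 0) (z : E) :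
    parabolicDilation N s (parabolicDilation N s⁻¹ z) = z := by
  rw [h.parabolicDilation_comp, mul_inv_cancel₀ hs, parabolicDilation_one]

lemma parabolicDilation_inv_left {s : ℝ} (hs : s ≠ 0) (z : E) :
    parabolicDilation N s⁻¹ (parabolicDilation N s z) = z := by
  rw [h.parabolicDilation_comp, inv_mul_cancel₀ hs, parabolicDilation_one]

lemma norm_parabolicDilation_le {s : ℝ} (hs0 : 0 ≤ s) (hs1 : s ≤ 1) (z : E) :
    ‖parabolicDilation N s z‖ ≤ 2 * s * ‖z‖ := by
  rw [parabolicDilation_apply]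
  refine (norm_add_le _ _).trans ?_
  rw [norm_smul, norm_smul, h.norm_eq, Real.norm_eq_abs, Real.norm_eq_abs, abs_mul,
    abs_of_nonneg hs0, mul_one]
  have h1 : |⟪z, N⟫| ≤ ‖z‖ := by simpa [h.norm_eq] using abs_real_inner_le_norm z N
  have h2 : |s ^ 2 - s| ≤ s := by
    rw [abs_le]; constructor <;> nlinarith
  nlinarith [mul_le_mul h2 h1 (abs_nonneg _) hs0]

/-- For s ≠ 0 the dilation is s times a transvection of determinant 1 + (s - 1) = s. -/
lemma det_parabolicDilation [FiniteDimensional ℝ E] (hE : 0 < Module.finrank ℝ E) (s : ℝ) :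
    (parabolicDilation N s).det = s ^ (Module.finrank ℝ E + 1) := by
  rcases eq_or_ne s 0 with rfl | hs
  · have : parabolicDilation N (0 : ℝ) = 0 := by
      ext z; simp [parabolicDilation_apply]
    rw [this, zero_pow (by omega), ContinuousLinearMap.det]
    have hz : ((0 : E →L[ℝ] E) : E →ₗ[ℝ] E) = (0 : ℝ) • LinearMap.id := by simp
    rw [hz, LinearMap.det_smul, zero_pow hE.ne', zero_mul]
  · have : ((parabolicDilation N s : E →L[ℝ] E) : E →ₗ[ℝ] E) =
        s • LinearMap.transvection ((s - 1) • (innerSL ℝ N : E →ₗ[ℝ] ℝ)) N := by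
      ext z
      simp only [ContinuousLinearMap.coe_coe, parabolicDilation_apply, LinearMap.smul_apply,
        LinearMap.transvection.apply, innerSL_apply_apply, smul_add, smul_smul, smul_eq_mul,
        real_inner_comm]
      congr 2
      ring
    rw [ContinuousLinearMap.det, this, LinearMap.det_smul, LinearMap.transvection.det,
      LinearMap.smul_apply, ContinuousLinearMap.coe_coe, innerSL_apply_apply, h.inner_self,
      pow_succ]
    simp

omit h in
lemma continuous_heightAbove : Continuous (heightAbove N B) := by
  unfold heightAbove; fun_prop

lemma convexOn_form : ConvexOn ℝ Set.univ fun z => B z z := by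
  refine ⟨convex_univ, fun x _ y _ a b ha hb hab => ?_⟩
  have hxy := h.nonneg (x - y)
  simp only [map_sub, map_add, map_smul, _root_.sub_apply,
    _root_.add_apply, _root_.smul_apply, smul_eq_mul, h.symm y x]
    at hxy ⊢
  obtain rfl : b = 1 - a := by linarith
  nlinarith [mul_nonneg (mul_nonneg ha hb) hxy]

end IsTransverseForm

lemma IsPreconnected.subset_interior_of_disjoint_frontier {X : Type*} [TopologicalSpace X]
    {U S : Set X} (hU : IsPreconnected U) (hd : ∀ x ∈ U, x ∉ frontier S)
    (hne : (U ∩ S).Nonempty) : U ⊆ interior S := by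
  refine hU.subset_left_of_subset_union isOpen_interior
    (isClosed_closure (s := S)).isOpen_compl ?_ ?_ ?_
  · exact Set.disjoint_left.mpr fun x hx hx' => hx' (subset_closure (interior_subset hx))
  · intro x hx
    by_contra hx'
    rw [Set.mem_union, not_or] at hx'
    exact hd x hx ⟨by simpa using hx'.2, hx'.1⟩
  · obtain ⟨x, hx, hxS⟩ := hne
    refine ⟨x, hx, ?_⟩
    by_contra hx'
    exact hd x hx ⟨subset_closure hxS, hx'⟩

/-- The boundary of `S` osculates at the origin the paraboloid given by `N` and `B`. -/
structure IsOsculated (N : E) (B : E →L[ℝ] E →L[ℝ] ℝ) (S : Set E) : Prop where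
  form : IsTransverseForm N B
  convex : Convex ℝ S
  closed : IsClosed S
  interior_nonempty : (interior S).Nonempty
  zero_mem : (0 : E) ∈ S
  normal : ∀ z ∈ S, 0 ≤ ⟪z, N⟫
  frontier_bounds : ∀ ε : ℝ, 0 < ε → ∃ a : ℝ, 0 < a ∧ ∀ z ∈ frontier S, ‖z‖ ≤ a →
    (1 - ε) * B z z ≤ ⟪z, N⟫ ∧ ⟪z, N⟫ ≤ (1 + ε) * B z z

namespace IsOsculated

variable {N : E} {B : E →L[ℝ] E →L[ℝ] ℝ} {S : Set E} (h : IsOsculated N B S)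
include h

/-- The region above the steeper paraboloid inside a small ball is convex and misses the frontier.
It meets S on the segment from 0 to an interior point k: ⟨k, N⟩ > 0, while B is quadratic along the
segment. By connectedness it lies in S. -/
lemma mem_of_lt {ε : ℝ} (hε : 0 < ε) : ∃ a : ℝ, 0 < a ∧ ∀ z : E, ‖z‖ < a →
    (1 + ε) * B z z < ⟪z, N⟫ → z ∈ S := by
  obtain ⟨a, ha, hfr⟩ := h.frontier_bounds ε hε
  refine ⟨a, ha, ?_⟩
  set U : Set E := {z | z ∈ Metric.ball (0 : E) a ∧ (1 + ε) * B z z - ⟪z, N⟫ < 0} with hU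
  have hconv : Convex ℝ U := by
    have h1 : ConvexOn ℝ (Metric.ball (0 : E) a) fun z => (1 + ε) * B z z - ⟪z, N⟫ := by
      have h2 := (h.form.convexOn_form.smul (c := 1 + ε) (by linarith)).sub
        (((innerSL ℝ N) : E →ₗ[ℝ] ℝ).concaveOn convex_univ)
      refine (h2.subset (Set.subset_univ _) (convex_ball _ _)).congr fun z _ => ?_
      simp [real_inner_comm]
    exact h1.convex_lt 0
  have hsub : U ⊆ interior S := by
    refine hconv.isPreconnected.subset_interior_of_disjoint_frontier ?_ ?_
    · rintro z ⟨hz1, hz2⟩ hz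
      have := (hfr z hz (by simpa using (mem_ball_zero_iff.mp hz1).le)).2
      linarith
    · obtain ⟨k, hk⟩ := h.interior_nonempty
      have hkpos : 0 < ⟪k, N⟫ := by
        have hc : Filter.Tendsto (fun t : ℝ => k + (-t) • N) (nhdsWithin 0 (Set.Ioi 0)) (nhds k) := by
          have : Continuous fun t : ℝ => k + (-t) • N := by fun_prop
          simpa using (this.tendsto 0).mono_left nhdsWithin_le_nhds
        obtain ⟨t, ht, ht0⟩ := ((hc.eventually (isOpen_interior.mem_nhds hk)).and
          self_mem_nhdsWithin).exists
        have := h.normal _ (interior_subset ht)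
        rw [h.form.inner_add_smul] at this
        replace ht0 : 0 < t := ht0
        linarith
      have hc1 : Filter.Tendsto (fun t : ℝ => (1 + ε) * (t * B k k)) (nhdsWithin 0 (Set.Ioi 0))
          (nhds 0) := by
        have : Continuous fun t : ℝ => (1 + ε) * (t * B k k) := by fun_prop
        simpa using (this.tendsto 0).mono_left nhdsWithin_le_nhds
      have hc2 : Filter.Tendsto (fun t : ℝ => ‖t • k‖) (nhdsWithin 0 (Set.Ioi 0)) (nhds 0) := by
        have : Continuous fun t : ℝ => ‖t • k‖ := by fun_prop
        simpa using (this.tendsto 0).mono_left nhdsWithin_le_nhds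
      obtain ⟨t, ⟨⟨ht1, ht2⟩, ht3⟩, ht0⟩ := ((((hc1.eventually (gt_mem_nhds hkpos)).and
        (hc2.eventually (gt_mem_nhds ha))).and
        (nhdsWithin_le_nhds (gt_mem_nhds one_pos))).and self_mem_nhdsWithin).exists
      replace ht0 : 0 < t := ht0
      refine ⟨t • k, ⟨mem_ball_zero_iff.mpr ht2, ?_⟩, ?_⟩
      · have e : (1 + ε) * B (t • k) (t • k) - ⟪t • k, N⟫ =
            t * ((1 + ε) * (t * B k k) - ⟪k, N⟫) := by
          rw [inner_smul_left]; simp; ring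
        rw [e]
        exact mul_neg_of_pos_of_neg ht0 (by linarith)
      · have := h.convex.add_smul_mem_interior h.zero_mem (by simpa using hk) (t := t)
          ⟨ht0, ht3.le⟩
        simpa using interior_subset this
  intro z hz hlt
  exact interior_subset (hsub ⟨mem_ball_zero_iff.mpr hz, by linarith⟩)

/-- Descend from z along -N by more than its height: the path leaves the supporting half-space, so
it meets the frontier. There B has the same value and the height is no larger, so the frontier bound
passes to z. -/
lemma le_of_mem {ε : ℝ} (hε : 0 < ε) : ∃ a : ℝ, 0 < a ∧ ∀ z ∈ S, ‖z‖ < a →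
    (1 - ε) * B z z ≤ ⟪z, N⟫ := by
  obtain ⟨a, ha, hfr⟩ := h.frontier_bounds ε hε
  refine ⟨a, ha, fun z hz hza => ?_⟩
  set w := ⟪z, N⟫ with hw
  have hw0 : 0 ≤ w := h.normal z hz
  set U := (fun τ : ℝ => z + (-τ) • N) '' Set.Icc 0 (w + 1) with hU
  have hpre : IsPreconnected U := isPreconnected_Icc.image _ (Continuous.continuousOn (by fun_prop))
  by_cases hd : ∀ x ∈ U, x ∉ frontier S
  · have hsub := hpre.subset_interior_of_disjoint_frontier hd
      ⟨z, ⟨0, ⟨le_rfl, by linarith⟩, by simp⟩, hz⟩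
    have := h.normal _ (interior_subset (hsub ⟨w + 1, ⟨by linarith, le_rfl⟩, rfl⟩))
    rw [h.form.inner_add_smul] at this
    linarith
  · push Not at hd
    obtain ⟨_, ⟨τ, ⟨hτ0, -⟩, rfl⟩, hx⟩ := hd
    have hxS : z + (-τ) • N ∈ S := h.closed.frontier_subset hx
    have h0 := h.normal _ hxS
    rw [h.form.inner_add_smul, ← hw] at h0
    have hn : ‖z + (-τ) • N‖ ≤ a := by
      have : ‖z + (-τ) • N‖ ^ 2 ≤ ‖z‖ ^ 2 := by
        rw [norm_add_sq_real, inner_smul_right, ← hw, norm_smul, h.form.norm_eq, Real.norm_eq_abs,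
          mul_one, sq_abs]
        nlinarith
      exact (pow_le_pow_iff_left₀ (norm_nonneg _) (norm_nonneg _) two_ne_zero).mp this |>.trans
        hza.le
    have := (hfr _ hx hn).1
    rw [h.form.apply_add_smul, h.form.inner_add_smul, ← hw] at this
    linarith

/-- The parabolic rescalings of `S` converge locally to the epigraph of the paraboloid. -/
lemma eventually_rescaled (R : ℝ) {ε : ℝ} (hε : 0 < ε) [FiniteDimensional ℝ E] :
    ∀ᶠ s in nhdsWithin (0 : ℝ) (Set.Ioi 0), ∀ z : E, ‖z‖ ≤ R →
      (ε ≤ heightAbove N B z → parabolicDilation N s z ∈ S) ∧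
      (parabolicDilation N s z ∈ S → -ε ≤ heightAbove N B z) := by
  obtain ⟨M, hM⟩ := (isCompact_closedBall (0 : E) R).exists_bound_of_continuousOn
    (f := fun z => B z z) (Continuous.continuousOn (by fun_prop))
  -- Turns the relative error of the curvature condition into an additive one, B being bounded by
  -- |M| on the ball.
  set ε' := ε / (|M| + 1) with hε'
  have hε'0 : 0 < ε' := by positivity
  have hεB : ∀ z : E, ‖z‖ ≤ R → ε' * B z z < ε := by
    intro z hz
    have h1 : B z z ≤ |M| := (le_abs_self _).trans
      ((hM z (mem_closedBall_zero_iff.mpr hz)).trans (le_abs_self _))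
    have h2 : ε' * (|M| + 1) = ε := by rw [hε']; field_simp
    nlinarith
  obtain ⟨a₁, ha₁, h₁⟩ := h.mem_of_lt hε'0
  obtain ⟨a₂, ha₂, h₂⟩ := h.le_of_mem hε'0
  have hc : Filter.Tendsto (fun s : ℝ => 2 * s * |R|) (nhdsWithin 0 (Set.Ioi 0)) (nhds 0) := by
    have : Continuous fun s : ℝ => 2 * s * |R| := by fun_prop
    simpa using (this.tendsto 0).mono_left nhdsWithin_le_nhds
  filter_upwards [hc.eventually (gt_mem_nhds ha₁), hc.eventually (gt_mem_nhds ha₂),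
    nhdsWithin_le_nhds (gt_mem_nhds one_pos), self_mem_nhdsWithin] with s hs1 hs2 hs3 hs0 z hz
  simp only [Set.mem_Ioi] at hs0
  have hn : ‖parabolicDilation N s z‖ ≤ 2 * s * |R| :=
    (h.form.norm_parabolicDilation_le hs0.le hs3.le z).trans
      (mul_le_mul_of_nonneg_left (hz.trans (le_abs_self _)) (by positivity))
  have hsq : 0 < s ^ 2 := by positivity
  have hB := hεB z hz
  constructor
  · intro hψ
    refine h₁ _ (hn.trans_lt hs1) ?_
    rw [h.form.form_parabolicDilation, h.form.inner_parabolicDilation]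
    rw [heightAbove] at hψ
    nlinarith
  · intro hmem
    have := h₂ _ hmem (hn.trans_lt hs2)
    rw [h.form.form_parabolicDilation, h.form.inner_parabolicDilation] at this
    have h3 : (1 - ε') * B z z ≤ ⟪z, N⟫ := by
      by_contra hlt
      push Not at hlt
      nlinarith
    rw [heightAbove]
    linarith

end IsOsculated

end LocalGeometry

/-! ### Caps and spikes in the rescaled picture. -/

section Caps

variable {E : Type*} [NormedAddCommGroup E] [InnerProductSpace ℝ E]

/-- The affine function whose zero set is tangent at `v + B v v • N` to the paraboloid of `B`. -/
noncomputable def tangentHeight (N : E) (B : E →L[ℝ] E →L[ℝ] ℝ) (v z : E) : ℝ :=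
  ⟪z, N⟫ - 2 * B z v + B v v

lemma continuous_tangentHeight (N : E) (B : E →L[ℝ] E →L[ℝ] ℝ) (v : E) :
    Continuous (tangentHeight N B v) := by
  unfold tangentHeight; fun_prop

lemma tangentHeight_combo (N : E) (B : E →L[ℝ] E →L[ℝ] ℝ) (v x y : E) {a b : ℝ}
    (hab : a + b = 1) : tangentHeight N B v (a • x + b • y) =
      a * tangentHeight N B v x + b * tangentHeight N B v y := by
  obtain rfl : b = 1 - a := by linarith
  simp only [tangentHeight, inner_add_left, inner_smul_left, map_add, map_smul, _root_.add_apply,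
    _root_.smul_apply, smul_eq_mul, RCLike.conj_to_real]
  ring

namespace IsTransverseForm

variable {N : E} {B : E →L[ℝ] E →L[ℝ] ℝ} (h : IsTransverseForm N B)
include h

/-- Completing the square: the tangent hyperplane lies below the paraboloid by B(z - v, z - v),
which vanishes only on the normal line through v. -/
lemma tangentHeight_eq (v z : E) :
    tangentHeight N B v z = heightAbove N B z + B (z - v) (z - v) := by
  simp only [tangentHeight, heightAbove, map_sub, _root_.sub_apply, h.symm v z]
  ring

lemma tangentHeight_add_smul (v z : E) (t : ℝ) :
    tangentHeight N B v (z + t • N) = tangentHeight N B v z + t := by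
  rw [h.tangentHeight_eq, h.tangentHeight_eq, h.heightAbove_add_smul,
    show z + t • N - v = (z - v) + t • N by abel, h.apply_add_smul]
  ring

lemma heightAbove_point {v : E} (hv : ⟪v, N⟫ = 0) : heightAbove N B (v + B v v • N) = 0 := by
  rw [h.heightAbove_add_smul, heightAbove, hv]; ring

lemma tangentHeight_point {v : E} (hv : ⟪v, N⟫ = 0) :
    tangentHeight N B v (v + B v v • N) = 0 := by
  rw [h.tangentHeight_add_smul, h.tangentHeight_eq, heightAbove, hv]; simp

lemma exists_le_form [FiniteDimensional ℝ E] :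
    ∃ c : ℝ, 0 < c ∧ ∀ u : E, ⟪u, N⟫ = 0 → c * ‖u‖ ^ 2 ≤ B u u := by
  have hcomp : IsCompact (Metric.sphere (0 : E) 1 ∩ {u : E | ⟪u, N⟫ = 0}) :=
    (isCompact_sphere _ _).inter_right (isClosed_eq (by fun_prop) continuous_const)
  obtain ⟨c, hc, hle⟩ := hcomp.exists_forall_le' (f := fun u => B u u) (a := 0)
    (Continuous.continuousOn (by fun_prop)) (by
      rintro u ⟨hu1, hu2⟩
      refine h.pos u hu2 ?_
      rintro rfl
      simp at hu1)
  refine ⟨c, hc, fun u hu => ?_⟩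
  rcases eq_or_ne u 0 with rfl | hu0
  · simp
  have hn : 0 < ‖u‖ := norm_pos_iff.mpr hu0
  have := hle (‖u‖⁻¹ • u) ⟨by simp [norm_smul, hn.ne'],
    by simp [inner_smul_left, hu]⟩
  simp only [map_smul, _root_.smul_apply, smul_eq_mul] at this
  have h2 : B u u = ‖u‖ ^ 2 * (‖u‖⁻¹ * (‖u‖⁻¹ * B u u)) := by field_simp
  rw [h2, mul_comm c]
  exact mul_le_mul_of_nonneg_left this (by positivity)

/-- Height at most 8 and `heightAbove` at least -1 give B ≤ 9 and |w| ≤ 8, hence a bounded norm.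
Applied in `IsOsculated.exists_spike` to points of the rescaled body far from the origin. -/
lemma exists_inner_gt_of_norm_eq [FiniteDimensional ℝ E] :
    ∃ R₀ : ℝ, ∀ m : E, R₀ ≤ ‖m‖ → -1 ≤ heightAbove N B m → 8 < ⟪m, N⟫ := by
  obtain ⟨c, hc, hle⟩ := h.exists_le_form
  refine ⟨√(9 / c + 64) + 1, fun m hm hψ => ?_⟩
  by_contra hw
  push Not at hw
  set w := ⟪m, N⟫ with hwdef
  set u := m + (-w) • N with hu
  have hBu : B u u = B m m := h.apply_add_smul _ _
  have hu0 : ⟪u, N⟫ = 0 := by rw [hu, h.inner_add_smul]; ring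
  have h1 := hle u hu0
  rw [hBu] at h1
  have h0 := h.nonneg m
  rw [heightAbove, ← hwdef] at hψ
  have hm' : m = u + w • N := by rw [hu]; simp
  have h2 : ‖m‖ ^ 2 = ‖u‖ ^ 2 + w ^ 2 := by
    rw [hm', norm_add_sq_real, inner_smul_right, hu0, norm_smul, h.norm_eq, Real.norm_eq_abs,
      mul_one, sq_abs]
    ring
  have h3 : ‖u‖ ^ 2 ≤ 9 / c := by
    rw [le_div_iff₀ hc]; linarith
  have h4 : ‖m‖ ≤ √(9 / c + 64) := by
    apply Real.le_sqrt_of_sq_le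
    nlinarith
  linarith

end IsTransverseForm

namespace IsOsculated

variable {N : E} {B : E →L[ℝ] E →L[ℝ] ℝ} {S : Set E} (h : IsOsculated N B S)
include h

lemma rescaled_combo {s : ℝ} {x y : E} (hx : parabolicDilation N s x ∈ S)
    (hy : parabolicDilation N s y ∈ S) {a b : ℝ} (ha : 0 ≤ a) (hb : 0 ≤ b) (hab : a + b = 1) :
    parabolicDilation N s (a • x + b • y) ∈ S := by
  rw [map_add, map_smul, map_smul]
  exact h.convex hx hy ha hb hab

/-- Caps cut off by hyperplanes nearly tangent at a given point of the limit paraboloid stay near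
that point. -/
lemma exists_cap [FiniteDimensional ℝ E] {v : E} (hv : ⟪v, N⟫ = 0) {ρ : ℝ} (hρ : 0 < ρ) :
    ∃ η : ℝ, ∃ W : Set E, 0 < η ∧ IsOpen W ∧ W.Nonempty ∧ (∀ z ∈ W, tangentHeight N B v z < η) ∧
      ∀ᶠ s in nhdsWithin (0 : ℝ) (Set.Ioi 0),
        (∀ z, parabolicDilation N s z ∈ S → tangentHeight N B v z < η →
          ‖z - (v + B v v • N)‖ < ρ) ∧ ∀ z ∈ W, parabolicDilation N s z ∈ S := by
  set p := v + B v v • N with hp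
  have hf := h.form
  have hcψ : Continuous (heightAbove N B) := IsTransverseForm.continuous_heightAbove
  have hcℓ := continuous_tangentHeight N B v
  -- A point above the paraboloid and below its tangent hyperplane at p must be p, so the maximum is
  -- positive on the sphere about p.
  obtain ⟨η, hη, hle⟩ := (isCompact_sphere p ρ).exists_forall_le'
    (f := fun z => max (tangentHeight N B v z) (-heightAbove N B z)) (a := 0)
    (Continuous.continuousOn (hcℓ.max hcψ.neg)) (by
      intro z hz
      by_contra hle
      rw [not_lt, max_le_iff, hf.tangentHeight_eq] at hle
      have h0 := hf.nonneg (z - v)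
      have h1 : B (z - v) (z - v) = 0 := by linarith
      have h2 : heightAbove N B z = 0 := by linarith
      have h3 := hf.eq_of_apply_self_eq_zero h1
      have h4 : z = v + ⟪z - v, N⟫ • N := by rw [← h3]; abel
      have h5 : z = p := by
        rw [h4, hf.heightAbove_add_smul, heightAbove, hv] at h2
        rw [h4, hp]
        congr 2
        linarith
      rw [h5] at hz
      simp at hz
      exact hρ.ne hz)
  set τ := min (η / 2) (ρ / 2) with hτ
  have hτ0 : 0 < τ := by positivity
  have hτη : τ ≤ η / 2 := min_le_left _ _
  have hτρ : τ ≤ ρ / 2 := min_le_right _ _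
  set W := {z | τ / 2 < heightAbove N B z} ∩ ({z | tangentHeight N B v z < η} ∩ Metric.ball p ρ)
    with hW
  have hWp : p + τ • N ∈ W := by
    refine ⟨?_, ?_, ?_⟩
    · change τ / 2 < heightAbove N B (p + τ • N)
      rw [hf.heightAbove_add_smul, hf.heightAbove_point hv]; linarith
    · change tangentHeight N B v (p + τ • N) < η
      rw [hf.tangentHeight_add_smul, hf.tangentHeight_point hv]; linarith
    · rw [mem_ball_iff_norm, add_sub_cancel_left, norm_smul, hf.norm_eq, Real.norm_eq_abs,
        abs_of_pos hτ0]
      linarith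
  refine ⟨η, W, hη, ?_, ⟨_, hWp⟩, fun z hz => hz.2.1, ?_⟩
  · exact (isOpen_lt continuous_const hcψ).inter ((isOpen_lt hcℓ continuous_const).inter
      Metric.isOpen_ball)
  · have hR : ∀ z, ‖z - p‖ ≤ ρ → ‖z‖ ≤ ‖p‖ + ρ := fun z hz => by
      have := norm_add_le (z - p) p
      rw [sub_add_cancel] at this
      linarith
    filter_upwards [h.eventually_rescaled (‖p‖ + ρ) (half_pos hτ0),
      h.eventually_rescaled (‖p‖ + ρ) (half_pos hη)] with s hs1 hs2
    have hWS : ∀ z ∈ W, parabolicDilation N s z ∈ S := fun z hz =>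
      (hs1 z (hR z (mem_ball_iff_norm.mp hz.2.2).le)).1 hz.1.le
    refine ⟨fun z hz hzℓ => ?_, hWS⟩
    by_contra hfar
    push Not at hfar
    -- A far point of the cap would, by convexity, produce a cap point on the sphere; there
    -- `heightAbove` is at most -η, against the bound -η / 2 for the rescaled body.
    have hconn : IsPreconnected (segment ℝ (p + τ • N) z) := (convex_segment _ _).isPreconnected
    obtain ⟨y, hy, hyρ⟩ := hconn.intermediate_value (left_mem_segment ℝ _ _)
      (right_mem_segment ℝ _ _) (f := fun y => ‖y - p‖) (Continuous.continuousOn (by fun_prop))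
      ⟨(mem_ball_iff_norm.mp hWp.2.2).le, hfar⟩
    obtain ⟨a, b, ha, hb, hab, rfl⟩ := hy
    have hyS := h.rescaled_combo (hWS _ hWp) hz ha hb hab
    have hyℓ : tangentHeight N B v (a • (p + τ • N) + b • z) < η := by
      rw [tangentHeight_combo _ _ _ _ _ hab]
      have h1 : tangentHeight N B v (p + τ • N) < η := hWp.2.1
      obtain rfl : a = 1 - b := by linarith
      rcases hb.eq_or_lt with rfl | hb0
      · simpa using h1
      · nlinarith
    have h1 := hle _ (mem_sphere_iff_norm.mpr hyρ)
    have h2 := (hs2 _ (hR _ hyρ.le)).2 hyS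
    rcases le_max_iff.mp h1 with h3 | h3 <;> linarith

/-- The region added by taking the convex hull with a point slightly below the paraboloid. -/
lemma exists_spike [FiniteDimensional ℝ E] :
    ∃ R : ℝ, ∃ W : Set E, IsOpen W ∧ W.Nonempty ∧ (∀ z ∈ W, heightAbove N B z ≤ -(1 / 4)) ∧
      ∀ ε : ℝ, 0 < ε → ∀ᶠ s in nhdsWithin (0 : ℝ) (Set.Ioi 0),
        (∀ z, parabolicDilation N s z ∈ convexJoin ℝ {parabolicDilation N s (-N)} S \ S →
          ‖z‖ ≤ R ∧ heightAbove N B z ≤ ε) ∧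
        ∀ z ∈ W, parabolicDilation N s z ∈ convexJoin ℝ {parabolicDilation N s (-N)} S \ S := by
  have hf := h.form
  have hcψ : Continuous (heightAbove N B) := IsTransverseForm.continuous_heightAbove
  obtain ⟨R₀, hR₀⟩ := hf.exists_inner_gt_of_norm_eq
  set R := max R₀ 7 with hR
  have hR7 : 7 ≤ R := le_max_right _ _
  have hψ0 : heightAbove N B (0 : E) = 0 := by simp [heightAbove]
  -- Since z = (3/4)(-N) + (1/4)(4z + 3N), such z are joined to the apex by a point of the rescaled
  -- body and yet lie below it; z = -N/2 is one of them. The norm of 4z + 3N is below 7, whence the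
  -- 7 in R.
  set W := {z | heightAbove N B z < -(1 / 4)} ∩ ({z | 1 / 2 < heightAbove N B ((4 : ℝ) • z +
    (3 : ℝ) • N)} ∩ Metric.ball (0 : E) 1) with hW
  have hW7 : ∀ z ∈ W, ‖(4 : ℝ) • z + (3 : ℝ) • N‖ ≤ R := by
    intro z hz
    have h1 : ‖z‖ < 1 := mem_ball_zero_iff.mp hz.2.2
    refine (norm_add_le _ _).trans ?_
    rw [norm_smul, norm_smul, hf.norm_eq]
    norm_num
    linarith
  refine ⟨R, W, ?_, ⟨-(1 / 2 : ℝ) • N, ?_, ?_, ?_⟩, fun z hz => le_of_lt hz.1, ?_⟩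
  · exact (isOpen_lt hcψ continuous_const).inter ((isOpen_lt continuous_const
      (hcψ.comp (by fun_prop))).inter Metric.isOpen_ball)
  · have := hf.heightAbove_add_smul 0 (-(1 / 2))
    rw [zero_add, hψ0] at this
    change heightAbove N B (-(1 / 2 : ℝ) • N) < -(1 / 4)
    rw [this]; norm_num
  · have := hf.heightAbove_add_smul 0 1
    rw [zero_add, hψ0] at this
    change 1 / 2 < heightAbove N B ((4 : ℝ) • (-(1 / 2 : ℝ) • N) + (3 : ℝ) • N)
    rw [smul_smul, ← add_smul, show (4 : ℝ) * -(1 / 2) + 3 = 1 by norm_num, this]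
    norm_num
  · rw [mem_ball_zero_iff, norm_smul, hf.norm_eq]; norm_num
  · intro ε hε
    filter_upwards [h.eventually_rescaled R hε, h.eventually_rescaled R one_pos,
      h.eventually_rescaled R (ε := 1 / 2) (by norm_num),
      h.eventually_rescaled R (ε := 1 / 8) (by norm_num), self_mem_nhdsWithin] with s hs1 hs2 hs3
      hs4 hs0
    replace hs0 : s ≠ 0 := ne_of_gt hs0
    constructor
    · rintro z ⟨hzj, hzS⟩
      suffices hzR : ‖z‖ ≤ R by
        refine ⟨hzR, ?_⟩
        by_contra hlt
        push Not at hlt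
        exact hzS ((hs1 z hzR).1 hlt.le)
      obtain ⟨p', hp', k', hk', hz⟩ := mem_convexJoin.mp hzj
      rw [Set.mem_singleton_iff] at hp'
      subst hp'
      obtain ⟨a, t, ha, ht, hat, hz⟩ := hz
      obtain ⟨k, rfl⟩ : ∃ k, parabolicDilation N s k = k' :=
        ⟨_, hf.parabolicDilation_inv_right hs0 k'⟩
      obtain rfl : z = a • (-N) + t • k := by
        rw [← map_smul, ← map_smul, ← map_add] at hz
        have := congrArg (parabolicDilation N s⁻¹) hz
        rw [hf.parabolicDilation_inv_left hs0, hf.parabolicDilation_inv_left hs0] at this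
        exact this.symm
      have hle : ‖a • (-N) + t • k‖ ≤ a + t * ‖k‖ := by
        refine (norm_add_le _ _).trans ?_
        rw [norm_smul, norm_smul, norm_neg, hf.norm_eq, Real.norm_of_nonneg ha,
          Real.norm_of_nonneg ht, mul_one]
      by_cases hkR : ‖k‖ ≤ R
      · nlinarith
      push Not at hkR
      have hk0 : 0 < ‖k‖ := by linarith
      set τ := R / ‖k‖ with hτ
      have hτ0 : 0 < τ := by positivity
      have hτ1 : τ < 1 := by rw [hτ, div_lt_one hk0]; exact hkR
      have hτk : τ * ‖k‖ = R := by rw [hτ]; field_simp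
      -- With little weight on the far point k, the combination has norm at most 1 + R / 2. With
      -- more weight it lies between k and the point y below, which is already in the body, so
      -- nothing new is added.
      rcases lt_or_ge t (τ / 2) with htτ | htτ
      · have := mul_le_mul_of_nonneg_right htτ.le hk0.le
        linarith
      · exfalso
        have hmS : parabolicDilation N s (τ • k) ∈ S := by
          rw [map_smul]
          exact h.convex.smul_mem_of_zero_mem h.zero_mem hk' ⟨hτ0.le, hτ1.le⟩
        have hmn : ‖τ • k‖ = R := by rw [norm_smul, Real.norm_of_nonneg hτ0.le, hτk]
        have hmψ := (hs2 _ hmn.le).2 hmS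
        have hmw := hR₀ _ (by rw [hmn]; exact le_max_left _ _) hmψ
        set y := (1 - τ / 2) • (-N) + (τ / 2) • k with hy
        -- Halving m = τ k halves its height w > 8 but quarters B(m, m) ≤ w + 1, so y stays above
        -- the paraboloid even after going down by at most 1.
        have hyψ : 1 / 2 ≤ heightAbove N B y := by
          have e : y = (1 / 2 : ℝ) • (τ • k) + (-(1 - τ / 2)) • N := by
            rw [hy, smul_smul]; module
          rw [e, hf.heightAbove_add_smul]
          rw [heightAbove] at hmψ ⊢
          simp only [inner_smul_left (τ • k), map_smul (B) (1 / 2 : ℝ), map_smul _ (1 / 2 : ℝ),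
            _root_.smul_apply, smul_eq_mul, RCLike.conj_to_real] at hmψ ⊢
          linarith
        have hyn : ‖y‖ ≤ R := by
          rw [hy]
          refine (norm_add_le _ _).trans ?_
          rw [norm_smul, norm_smul, norm_neg, hf.norm_eq, Real.norm_of_nonneg (by linarith),
            Real.norm_of_nonneg (by linarith)]
          linarith
        have hyS := (hs3 y hyn).1 hyψ
        have hden : 0 < 1 - τ / 2 := by linarith
        apply hzS
        have e : a • (-N) + t • k = (a / (1 - τ / 2)) • y + (1 - a / (1 - τ / 2)) • k := by
          rw [hy, smul_add, smul_smul, smul_smul, add_assoc, ← add_smul, div_mul_cancel₀ _ hden.ne']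
          congr 2
          linear_combination hat + div_mul_cancel₀ a hden.ne'
        rw [e]
        refine h.rescaled_combo hyS hk' (by positivity) ?_ (by ring)
        rw [sub_nonneg, div_le_one hden]
        linarith
    · intro z hz
      have hk := (hs3 _ (hW7 z hz)).1 (le_of_lt hz.2.1)
      have hzn : ‖z‖ ≤ R := by
        have := mem_ball_zero_iff.mp hz.2.2
        linarith
      refine ⟨mem_convexJoin.mpr ⟨_, rfl, _, hk, 3 / 4, 1 / 4, by norm_num, by norm_num,
        by norm_num, ?_⟩, fun hzS => ?_⟩
      · rw [← map_smul, ← map_smul, ← map_add]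
        congr 1
        module
      · have := (hs4 z hzn).2 hzS
        have h2 : heightAbove N B z < -(1 / 4) := hz.1
        linarith

end IsOsculated

end Caps

lemma IsCompact.convexJoin_singleton {E : Type*} [AddCommGroup E] [Module ℝ E]
    [TopologicalSpace E] [ContinuousAdd E] [ContinuousSMul ℝ E] {S : Set E} (hS : IsCompact S)
    (p : E) : IsCompact (convexJoin ℝ {p} S) := by
  have : convexJoin ℝ {p} S =
      (fun q : ℝ × E => (1 - q.1) • p + q.1 • q.2) '' (Set.Icc 0 1 ×ˢ S) := by
    ext x
    simp only [convexJoin_singleton_left, Set.mem_iUnion, segment_eq_image, Set.mem_image,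
      Set.mem_prod, Prod.exists]
    constructor
    · rintro ⟨k, hk, t, ht, rfl⟩
      exact ⟨t, k, ⟨ht, hk⟩, rfl⟩
    · rintro ⟨t, k, ⟨ht, hk⟩, rfl⟩
      exact ⟨k, hk, t, ht, rfl⟩
  rw [this]
  exact (isCompact_Icc.prod hS).image (by fun_prop)

/-! ### Integrals over small caps and spikes. -/

section CapIntegrals

variable {E : Type*} [NormedAddCommGroup E] [InnerProductSpace ℝ E] [FiniteDimensional ℝ E]
  [MeasurableSpace E] [BorelSpace E] (μ : Measure E) [μ.IsAddHaarMeasure]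

namespace IsOsculated

variable {N : E} {B : E →L[ℝ] E →L[ℝ] ℝ} {S : Set E} (h : IsOsculated N B S)
include h

/-- A function whose leading term at some point of the limit paraboloid is negative has negative
integral over the caps near this point. -/
lemma exists_cap_integral_le {f : E → ℝ} (hf : Continuous f) {k : ℕ} (hk : k ≤ 2)
    {G : ℝ → E → ℝ} (hG : Continuous (Function.uncurry G))
    (hfG : ∀ s z, f (parabolicDilation N s z) = s ^ k * G s z) {v : E} (hv : ⟪v, N⟫ = 0)
    (hneg : G 0 (v + B v v • N) < 0) :
    ∃ η R c : ℝ, 0 < c ∧ ∀ᶠ s in nhdsWithin (0 : ℝ) (Set.Ioi 0),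
      (∀ z, parabolicDilation N s z ∈ S → tangentHeight N B v z < η → ‖z‖ ≤ R) ∧
      ∫ z in {z | parabolicDilation N s z ∈ S ∧ tangentHeight N B v z < η},
        f (parabolicDilation N s z) ∂μ ≤ -(c * s ^ 2) := by
  set p := v + B v v • N with hp
  set m := -(G 0 p) / 2 with hm
  have hm0 : 0 < m := by rw [hm]; linarith
  obtain ⟨ρ, hρ, hball⟩ : ∃ ρ > 0, ∀ s z, |s| < ρ → ‖z - p‖ < ρ → G s z < -m := by
    have ho : {q : ℝ × E | Function.uncurry G q < -m} ∈ nhds ((0 : ℝ), p) :=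
      hG.continuousAt.eventually (gt_mem_nhds (show G 0 p < -m by rw [hm]; linarith))
    obtain ⟨ρ, hρ, hsub⟩ := Metric.mem_nhds_iff.mp ho
    refine ⟨ρ, hρ, fun s z hs hz => hsub (a := (s, z)) ?_⟩
    rw [← ball_prod_same]
    exact ⟨by simpa using hs, mem_ball_iff_norm.mpr hz⟩
  obtain ⟨η, W, hη, hWo, hWne, hWℓ, hev⟩ := h.exists_cap hv hρ
  have hballfin : ∀ R, μ (Metric.closedBall (0 : E) R) ≠ ⊤ := fun R =>
    (isCompact_closedBall (0 : E) R).measure_lt_top.ne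
  have hR : ∀ z, ‖z - p‖ ≤ ρ → ‖z‖ ≤ ‖p‖ + ρ := fun z hz => by
    have := norm_add_le (z - p) p
    rw [sub_add_cancel] at this
    linarith
  obtain ⟨s₀, hs₀, hs₀'⟩ := (hev.and self_mem_nhdsWithin).exists
  have hWR : W ⊆ Metric.closedBall 0 (‖p‖ + ρ) := fun z hz =>
    mem_closedBall_zero_iff.mpr (hR z (hs₀.1 z (hs₀.2 z hz) (hWℓ z hz)).le)
  have hWpos : 0 < μ.real W := ENNReal.toReal_pos (hWo.measure_pos μ hWne).ne'
    (measure_mono hWR |>.trans_lt (lt_top_iff_ne_top.mpr (hballfin _))).ne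
  refine ⟨η, ‖p‖ + ρ, m * μ.real W, by positivity, ?_⟩
  filter_upwards [hev, nhdsWithin_le_nhds (gt_mem_nhds hρ),
    nhdsWithin_le_nhds (gt_mem_nhds one_pos), self_mem_nhdsWithin] with s hs hsρ hs1 hs0
  replace hs0 : 0 < s := hs0
  have hloc : ∀ z, parabolicDilation N s z ∈ S → tangentHeight N B v z < η → ‖z‖ ≤ ‖p‖ + ρ :=
    fun z hz hzℓ => hR z (hs.1 z hz hzℓ).le
  refine ⟨hloc, ?_⟩
  set D := {z | parabolicDilation N s z ∈ S ∧ tangentHeight N B v z < η} with hD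
  have hDm : MeasurableSet D :=
    (h.closed.preimage (parabolicDilation N s).continuous).measurableSet.inter
      (isOpen_lt (continuous_tangentHeight N B v) continuous_const).measurableSet
  have hDsub : D ⊆ Metric.closedBall 0 (‖p‖ + ρ) := fun z hz =>
    mem_closedBall_zero_iff.mpr (hloc z hz.1 hz.2)
  have hDfin : μ D ≠ ⊤ := (measure_mono hDsub |>.trans_lt
    (lt_top_iff_ne_top.mpr (hballfin _))).ne
  have hint : IntegrableOn (fun z => f (parabolicDilation N s z)) D μ :=
    ((hf.comp (parabolicDilation N s).continuous).continuousOn.integrableOn_compact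
      (isCompact_closedBall _ _)).mono_set hDsub
  have hle : ∫ z in D, f (parabolicDilation N s z) ∂μ ≤ ∫ _ in D, -(m * s ^ 2) ∂μ := by
    refine setIntegral_mono_on hint (integrableOn_const hDfin) hDm fun z hz => ?_
    rw [hfG]
    have h1 := hball s z (by rwa [abs_of_pos hs0]) (hs.1 z hz.1 hz.2)
    -- All orders k ≤ 2 are reduced to the worst one, so that every case ends with the same power of
    -- s.
    have h2 : s ^ 2 ≤ s ^ k := pow_le_pow_of_le_one hs0.le hs1.le hk
    have h3 : 0 < s ^ k := by positivity
    nlinarith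
  refine hle.trans ?_
  rw [setIntegral_const, smul_eq_mul]
  have hWD : μ.real W ≤ μ.real D := measureReal_mono (fun z hz => ⟨hs.2 z hz, hWℓ z hz⟩) hDfin
  have := mul_le_mul_of_nonneg_right hWD (show 0 ≤ m * s ^ 2 by positivity)
  linarith

/-- A function whose leading term is bounded below by the depth below the paraboloid has positive
integral over the region added by taking the convex hull with a point. -/
lemma exists_le_spike_integral (hS : IsCompact S) {f : E → ℝ} (hf : Continuous f) {k : ℕ}
    (hk : k ≤ 2) {G : ℝ → E → ℝ} (hG : Continuous (Function.uncurry G))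
    (hfG : ∀ s z, f (parabolicDilation N s z) = s ^ k * G s z)
    (hpos : ∀ R : ℝ, ∃ γ : ℝ, 0 < γ ∧ ∀ z, ‖z‖ ≤ R → -(γ * heightAbove N B z) ≤ G 0 z) :
    ∃ R c : ℝ, 0 < c ∧ ∀ᶠ s in nhdsWithin (0 : ℝ) (Set.Ioi 0),
      (∀ z, parabolicDilation N s z ∈ convexJoin ℝ {parabolicDilation N s (-N)} S \ S →
        ‖z‖ ≤ R) ∧
      c * s ^ 2 ≤ ∫ z in
        {z | parabolicDilation N s z ∈ convexJoin ℝ {parabolicDilation N s (-N)} S \ S},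
        f (parabolicDilation N s z) ∂μ := by
  obtain ⟨R, W, hWo, hWne, hWψ, hev⟩ := h.exists_spike
  obtain ⟨γ, hγ, hγG⟩ := hpos R
  have hballfin : μ (Metric.closedBall (0 : E) R) ≠ ⊤ :=
    (isCompact_closedBall (0 : E) R).measure_lt_top.ne
  obtain ⟨s₀, hs₀⟩ := (hev 1 one_pos).exists
  have hWR : W ⊆ Metric.closedBall 0 R := fun z hz =>
    mem_closedBall_zero_iff.mpr (hs₀.1 z (hs₀.2 z hz)).1
  have hWfin : μ W ≠ ⊤ := (measure_mono hWR |>.trans_lt (lt_top_iff_ne_top.mpr hballfin)).ne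
  have hWpos : 0 < μ.real W := ENNReal.toReal_pos (hWo.measure_pos μ hWne).ne' hWfin
  set vR := μ.real (Metric.closedBall (0 : E) R) with hvR
  have hWvR : μ.real W ≤ vR := measureReal_mono hWR hballfin
  have hvR0 : 0 < vR := hWpos.trans_le hWvR
  -- The possible loss 2 γ ε vR is then γ |W| / 12, against a gain γ |W| / 4 on W; this leaves more
  -- than γ |W| / 8.
  set ε := μ.real W / (24 * vR) with hε
  have hε0 : 0 < ε := by positivity
  have hεv : ε * vR = μ.real W / 24 := by rw [hε]; field_simp
  have hunif : ∀ᶠ s in nhdsWithin (0 : ℝ) (Set.Ioi 0), ∀ z ∈ Metric.closedBall (0 : E) R,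
      G 0 z - γ * ε < G s z := by
    have hc := (isCompact_closedBall (0 : E) R).eventually_forall_of_forall_eventually
      (x₀ := (0 : ℝ)) (P := fun s z => G 0 z - γ * ε < G s z) (by
        intro z _
        have h1 : Continuous fun q : ℝ × E => G q.1 q.2 - (G 0 q.2 - γ * ε) := by
          have h2 : Continuous fun q : ℝ × E => G 0 q.2 :=
            hG.comp (continuous_const.prodMk continuous_snd)
          exact hG.sub (h2.sub continuous_const)
        have h3 := h1.continuousAt (x := ((0 : ℝ), z)) |>.eventually
          (lt_mem_nhds (show (0 : ℝ) < _ by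
            change 0 < G 0 z - (G 0 z - γ * ε)
            have : 0 < γ * ε := by positivity
            linarith))
        filter_upwards [h3] with q hq
        linarith)
    exact nhdsWithin_le_nhds hc
  refine ⟨R, γ * μ.real W / 8, by positivity, ?_⟩
  filter_upwards [hev ε hε0, hunif, nhdsWithin_le_nhds (gt_mem_nhds one_pos),
    self_mem_nhdsWithin] with s hs hsG hs1 hs0
  replace hs0 : 0 < s := hs0
  refine ⟨fun z hz => (hs.1 z hz).1, ?_⟩
  set D := {z | parabolicDilation N s z ∈ convexJoin ℝ {parabolicDilation N s (-N)} S \ S} with hD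
  have hJ : IsCompact (convexJoin ℝ {parabolicDilation N s (-N)} S) := hS.convexJoin_singleton _
  have hDm : MeasurableSet D :=
    (parabolicDilation N s).continuous.measurable (hJ.measurableSet.diff hS.measurableSet)
  have hDsub : D ⊆ Metric.closedBall 0 R := fun z hz =>
    mem_closedBall_zero_iff.mpr (hs.1 z hz).1
  have hDfin : μ D ≠ ⊤ := (measure_mono hDsub |>.trans_lt (lt_top_iff_ne_top.mpr hballfin)).ne
  have hint : IntegrableOn (fun z => f (parabolicDilation N s z)) D μ :=
    ((hf.comp (parabolicDilation N s).continuous).continuousOn.integrableOn_compact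
      (isCompact_closedBall _ _)).mono_set hDsub
  have hWD : W ⊆ D := fun z hz => hs.2 z hz
  have hWint : IntegrableOn (W.indicator fun _ => γ / 4 * s ^ k) D μ :=
    (integrableOn_const hDfin).indicator hWo.measurableSet
  have hle : ∫ z in D, (-(2 * γ * ε * s ^ k) + W.indicator (fun _ => γ / 4 * s ^ k) z) ∂μ ≤
      ∫ z in D, f (parabolicDilation N s z) ∂μ := by
    refine setIntegral_mono_on ((integrableOn_const hDfin).add hWint) hint hDm fun z hz => ?_
    rw [hfG]
    have h1 := hsG z (hDsub hz)
    have h2 := hγG z (hs.1 z hz).1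
    have h3 : 0 < s ^ k := by positivity
    by_cases hzW : z ∈ W
    · rw [Set.indicator_of_mem hzW]
      have h4 := mul_le_mul_of_nonneg_left (hWψ z hzW) hγ.le
      have h5 : 0 < γ * ε := by positivity
      nlinarith
    · rw [Set.indicator_of_notMem hzW]
      have h4 := mul_le_mul_of_nonneg_left (hs.1 z hz).2 hγ.le
      nlinarith
  refine le_trans ?_ hle
  have hconst : IntegrableOn (fun _ : E => -(2 * γ * ε * s ^ k)) D μ := integrableOn_const hDfin
  rw [integral_add hconst hWint, setIntegral_const,
    setIntegral_indicator hWo.measurableSet, Set.inter_eq_right.mpr hWD, setIntegral_const,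
    smul_eq_mul, smul_eq_mul]
  have hDv : μ.real D ≤ vR := measureReal_mono hDsub hballfin
  have h2 : s ^ 2 ≤ s ^ k := pow_le_pow_of_le_one hs0.le hs1.le hk
  have h3 : 0 < s ^ k := by positivity
  have h4 : μ.real D * (2 * γ * ε * s ^ k) ≤ γ * s ^ k * (μ.real W / 12) := by
    have := mul_le_mul_of_nonneg_right hDv (show 0 ≤ 2 * γ * ε * s ^ k by positivity)
    calc _ ≤ _ := this
      _ = 2 * γ * s ^ k * (ε * vR) := by ring
      _ = _ := by rw [hεv]; ring
  have h5 : γ * μ.real W / 8 * s ^ 2 ≤ γ * μ.real W / 8 * s ^ k :=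
    mul_le_mul_of_nonneg_left h2 (by positivity)
  have h6 : 0 < γ * s ^ k * μ.real W := by positivity
  linarith

end IsOsculated

/-- Change of variables; the Jacobian is the source of the order `finrank + 1` of the volumes. -/
lemma IsTransverseForm.setIntegral_eq_rescaled {N : E} {B : E →L[ℝ] E →L[ℝ] ℝ}
    (h : IsTransverseForm N B) (hE : 0 < Module.finrank ℝ E) {s : ℝ} (hs : 0 < s) (X : E)
    {A : Set E} (hA : MeasurableSet A) (f : E → ℝ) :
    ∫ x in A, f x ∂μ = s ^ (Module.finrank ℝ E + 1) *
      ∫ z in {z | X + parabolicDilation N s z ∈ A}, f (X + parabolicDilation N s z) ∂μ := by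
  set T : E → E := fun z => X + parabolicDilation N s z with hT
  have hTc : Continuous T := by fun_prop
  have hinj : Function.Injective T := by
    intro x y hxy
    have h1 : parabolicDilation N s x = parabolicDilation N s y := add_left_cancel hxy
    rw [← h.parabolicDilation_inv_left hs.ne' x, h1, h.parabolicDilation_inv_left hs.ne']
  have himg : T '' {z | T z ∈ A} = A := by
    refine Set.image_preimage_eq _ fun x => ⟨parabolicDilation N s⁻¹ (x - X), ?_⟩
    rw [hT]
    simp only [h.parabolicDilation_inv_right hs.ne']
    abel
  have := integral_image_eq_integral_abs_det_fderiv_smul μ (s := {z | T z ∈ A})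
    (hTc.measurable hA) (f := T) (f' := fun _ => parabolicDilation N s)
    (fun x _ => ((parabolicDilation N s).hasFDerivAt.const_add X).hasFDerivWithinAt)
    hinj.injOn f
  rw [himg, h.det_parabolicDilation hE, abs_of_pos (by positivity)] at this
  simp only [smul_eq_mul] at this
  rw [this, integral_const_mul]

lemma IsTransverseForm.measureReal_eq_rescaled {N : E} {B : E →L[ℝ] E →L[ℝ] ℝ}
    (h : IsTransverseForm N B) (hE : 0 < Module.finrank ℝ E) {s : ℝ} (hs : 0 < s) (X : E)
    {A : Set E} (hA : MeasurableSet A) :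
    μ.real A = s ^ (Module.finrank ℝ E + 1) *
      μ.real {z | X + parabolicDilation N s z ∈ A} := by
  have := h.setIntegral_eq_rescaled μ hE hs X hA fun _ => 1
  simpa using this

end CapIntegrals

/-! ### The choice between a cap and a spike. -/

section Dichotomy

variable {E : Type*} [NormedAddCommGroup E] [InnerProductSpace ℝ E] [FiniteDimensional ℝ E]
  [MeasurableSpace E] [BorelSpace E] (μ : Measure E) [μ.IsAddHaarMeasure]

/-- Arbitrarily small caps of `K` at `X` on which the integral of `φ` is negative, with precise
orders of magnitude. -/
def HasNegativeCaps (K : Set E) (X : E) (φ : E → ℝ) : Prop :=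
  ∃ c C : ℝ, 0 < c ∧ 0 < C ∧ ∀ᶠ s in nhdsWithin (0 : ℝ) (Set.Ioi 0), ∃ (ℓ : E →L[ℝ] ℝ) (b : ℝ),
    K ∩ {x | ℓ x < b} ⊆ Metric.ball X (C * s) ∧
    μ.real (K ∩ {x | ℓ x < b}) ≤ C * s ^ (Module.finrank ℝ E + 1) ∧
    ∫ x in K ∩ {x | ℓ x < b}, φ x ∂μ ≤ -(c * s ^ (Module.finrank ℝ E + 3))

/-- Points outside `K` arbitrarily close to `X` such that the integral of `φ` on the region added
by joining them to `K` is positive, with precise orders of magnitude. -/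
def HasPositiveSpikes (K : Set E) (X : E) (φ : E → ℝ) : Prop :=
  ∃ c C : ℝ, 0 < c ∧ 0 < C ∧ ∀ᶠ s in nhdsWithin (0 : ℝ) (Set.Ioi 0), ∃ p : E,
    ‖p - X‖ ≤ C * s ∧ convexJoin ℝ {p} K \ K ⊆ Metric.ball X (C * s) ∧
    μ.real (convexJoin ℝ {p} K \ K) ≤ C * s ^ (Module.finrank ℝ E + 1) ∧
    c * s ^ (Module.finrank ℝ E + 3) ≤ ∫ x in convexJoin ℝ {p} K \ K, φ x ∂μ

/-- Returns `exists_cap_integral_le` to the original scale: the Jacobian times the order s² of the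
rescaled integral gives the exponent `finrank + 3`. -/
lemma hasNegativeCaps_of_leading_term (hE : 0 < Module.finrank ℝ E) {N X : E}
    {B : E →L[ℝ] E →L[ℝ] ℝ} {K : Set E} (hK : IsCompact K)
    (h : IsOsculated N B ((fun z => X + z) ⁻¹' K)) {φ : E → ℝ} (hφ : Continuous φ) {k : ℕ}
    (hk : k ≤ 2) {G : ℝ → E → ℝ} (hG : Continuous (Function.uncurry G))
    (hφG : ∀ s z, φ (X + parabolicDilation N s z) = s ^ k * G s z) {v : E} (hv : ⟪v, N⟫ = 0)
    (hneg : G 0 (v + B v v • N) < 0) : HasNegativeCaps μ K X φ := by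
  obtain ⟨η, R, c, hc, hev⟩ := h.exists_cap_integral_le μ (f := fun z => φ (X + z))
    (by fun_prop) hk hG hφG hv hneg
  set vR := μ.real (Metric.closedBall (0 : E) R) with hvR
  refine ⟨c, max (2 * |R| + 1) (vR + 1), hc, by positivity, ?_⟩
  filter_upwards [hev, nhdsWithin_le_nhds (gt_mem_nhds one_pos), self_mem_nhdsWithin] with s hs hs1
    hs0
  replace hs0 : 0 < s := hs0
  set L : E →L[ℝ] ℝ := innerSL ℝ N - (2 : ℝ) • B.flip v with hL
  have hLt : ∀ z, tangentHeight N B v z = L z + B v v := by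
    intro z
    simp [hL, tangentHeight, real_inner_comm]
  -- The rescaled tangent function is affine, so its sublevel set is a half-space in the original
  -- coordinates too.
  set ℓ : E →L[ℝ] ℝ := L.comp (parabolicDilation N s⁻¹) with hℓ
  have hℓz : ∀ z, ℓ (X + parabolicDilation N s z) = L z + ℓ X := by
    intro z
    rw [map_add, add_comm, hℓ]
    simp only [ContinuousLinearMap.comp_apply, h.form.parabolicDilation_inv_left hs0.ne']
  refine ⟨ℓ, η - B v v + ℓ X, ?_⟩
  set A := K ∩ {x | ℓ x < η - B v v + ℓ X} with hA
  have hAm : MeasurableSet A :=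
    hK.measurableSet.inter (isOpen_lt ℓ.continuous continuous_const).measurableSet
  have hD : {z | X + parabolicDilation N s z ∈ A} = {z | parabolicDilation N s z ∈
      (fun z => X + z) ⁻¹' K ∧ tangentHeight N B v z < η} := by
    ext z
    have e : ℓ (X + parabolicDilation N s z) < η - B v v + ℓ X ↔ tangentHeight N B v z < η := by
      rw [hℓz, hLt]; constructor <;> intro h <;> linarith
    exact and_congr Iff.rfl e
  refine ⟨?_, ?_, ?_⟩
  · intro x hx
    set z := parabolicDilation N s⁻¹ (x - X) with hz
    have hxz : X + parabolicDilation N s z = x := by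
      rw [hz, h.form.parabolicDilation_inv_right hs0.ne']; abel
    have hzD : z ∈ {z | X + parabolicDilation N s z ∈ A} := by
      change X + parabolicDilation N s z ∈ A
      rwa [hxz]
    rw [hD] at hzD
    have h1 := hs.1 z hzD.1 hzD.2
    have h2 := h.form.norm_parabolicDilation_le hs0.le hs1.le z
    rw [mem_ball_iff_norm, ← hxz, add_sub_cancel_left]
    have h3 : ‖z‖ ≤ |R| := h1.trans (le_abs_self _)
    calc _ ≤ 2 * s * ‖z‖ := h2
      _ ≤ 2 * s * |R| := by gcongr
      _ < (2 * |R| + 1) * s := by linarith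
      _ ≤ _ := by gcongr; exact le_max_left _ _
  · rw [h.form.measureReal_eq_rescaled μ hE hs0 X hAm, hD, mul_comm]
    refine mul_le_mul_of_nonneg_right ?_ (by positivity)
    refine (measureReal_mono (fun z hz => mem_closedBall_zero_iff.mpr (hs.1 z hz.1 hz.2))
      (isCompact_closedBall (0 : E) R).measure_lt_top.ne).trans ?_
    exact (by linarith : vR ≤ vR + 1).trans (le_max_right _ _)
  · rw [h.form.setIntegral_eq_rescaled μ hE hs0 X hAm, hD]
    have := mul_le_mul_of_nonneg_left hs.2
      (show 0 ≤ s ^ (Module.finrank ℝ E + 1) by positivity)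
    refine this.trans (le_of_eq ?_)
    ring

/-- Returns `exists_le_spike_integral` to the original scale, with apex X - s² N. -/
lemma hasPositiveSpikes_of_leading_term (hE : 0 < Module.finrank ℝ E) {N X : E}
    {B : E →L[ℝ] E →L[ℝ] ℝ} {K : Set E} (hK : IsCompact K)
    (h : IsOsculated N B ((fun z => X + z) ⁻¹' K)) {φ : E → ℝ} (hφ : Continuous φ) {k : ℕ}
    (hk : k ≤ 2) {G : ℝ → E → ℝ} (hG : Continuous (Function.uncurry G))
    (hφG : ∀ s z, φ (X + parabolicDilation N s z) = s ^ k * G s z)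
    (hpos : ∀ R : ℝ, ∃ γ : ℝ, 0 < γ ∧ ∀ z, ‖z‖ ≤ R → -(γ * heightAbove N B z) ≤ G 0 z) :
    HasPositiveSpikes μ K X φ := by
  have hS : IsCompact ((fun z => X + z) ⁻¹' K) :=
    (Homeomorph.addLeft X).isCompact_preimage.mpr hK
  obtain ⟨R, c, hc, hev⟩ := h.exists_le_spike_integral μ hS (f := fun z => φ (X + z))
    (by fun_prop) hk hG hφG hpos
  set vR := μ.real (Metric.closedBall (0 : E) R) with hvR
  refine ⟨c, max (2 * |R| + 2) (vR + 1), hc, by positivity, ?_⟩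
  filter_upwards [hev, nhdsWithin_le_nhds (gt_mem_nhds one_pos), self_mem_nhdsWithin] with s hs hs1
    hs0
  replace hs0 : 0 < s := hs0
  refine ⟨X + parabolicDilation N s (-N), ?_⟩
  set A := convexJoin ℝ {X + parabolicDilation N s (-N)} K \ K with hA
  have hAm : MeasurableSet A := (hK.convexJoin_singleton _).measurableSet.diff hK.measurableSet
  have hD : {z | X + parabolicDilation N s z ∈ A} = {z | parabolicDilation N s z ∈
      convexJoin ℝ {parabolicDilation N s (-N)} ((fun z => X + z) ⁻¹' K) \
        (fun z => X + z) ⁻¹' K} := by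
    ext z
    refine and_congr ?_ Iff.rfl
    simp only [mem_convexJoin, Set.mem_singleton_iff, exists_eq_left, Set.mem_preimage]
    constructor
    · rintro ⟨k, hk, a, b, ha, hb, hab, he⟩
      refine ⟨k - X, by simpa using hk, a, b, ha, hb, hab, ?_⟩
      obtain rfl : a = 1 - b := by linarith
      have : parabolicDilation N s z = (1 - b) • (X + parabolicDilation N s (-N)) + b • k - X := by
        rw [he]; abel
      rw [this]
      module
    · rintro ⟨k, hk, a, b, ha, hb, hab, he⟩
      refine ⟨X + k, hk, a, b, ha, hb, hab, ?_⟩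
      rw [← he]
      obtain rfl : a = 1 - b := by linarith
      module
  refine ⟨?_, ?_, ?_, ?_⟩
  · rw [add_sub_cancel_left]
    refine (h.form.norm_parabolicDilation_le hs0.le hs1.le _).trans ?_
    rw [norm_neg, h.form.norm_eq, mul_one]
    gcongr
    exact le_trans (by linarith [abs_nonneg R]) (le_max_left _ _)
  · intro x hx
    set z := parabolicDilation N s⁻¹ (x - X) with hz
    have hxz : X + parabolicDilation N s z = x := by
      rw [hz, h.form.parabolicDilation_inv_right hs0.ne']; abel
    have hzD : z ∈ {z | X + parabolicDilation N s z ∈ A} := by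
      change X + parabolicDilation N s z ∈ A
      rwa [hxz]
    rw [hD] at hzD
    have h1 := hs.1 z hzD
    have h2 := h.form.norm_parabolicDilation_le hs0.le hs1.le z
    rw [mem_ball_iff_norm, ← hxz, add_sub_cancel_left]
    have h3 : ‖z‖ ≤ |R| := h1.trans (le_abs_self _)
    calc _ ≤ 2 * s * ‖z‖ := h2
      _ ≤ 2 * s * |R| := by gcongr
      _ < (2 * |R| + 2) * s := by linarith
      _ ≤ _ := by gcongr; exact le_max_left _ _
  · rw [h.form.measureReal_eq_rescaled μ hE hs0 X hAm, hD, mul_comm]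
    refine mul_le_mul_of_nonneg_right ?_ (by positivity)
    refine (measureReal_mono (fun z hz => mem_closedBall_zero_iff.mpr (hs.1 z hz))
      (isCompact_closedBall (0 : E) R).measure_lt_top.ne).trans ?_
    exact (by linarith : vR ≤ vR + 1).trans (le_max_right _ _)
  · rw [h.form.setIntegral_eq_rescaled μ hE hs0 X hAm, hD]
    have := mul_le_mul_of_nonneg_left hs.2
      (show 0 ≤ s ^ (Module.finrank ℝ E + 1) by positivity)
    refine le_trans (le_of_eq ?_) this
    ring

/-- At a boundary point with positive curvature, a centred quadratic function always distinguishes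
some small cap or some small spike. -/
lemma hasNegativeCaps_or_hasPositiveSpikes (hE : 0 < Module.finrank ℝ E) {N X : E}
    {B : E →L[ℝ] E →L[ℝ] ℝ} {K : Set E} (hK : IsCompact K)
    (h : IsOsculated N B ((fun z => X + z) ⁻¹' K)) {P : E →L[ℝ] E}
    (hP : ∀ x y, ⟪P x, y⟫ = ⟪x, P y⟫) {g : E} (hg : 0 ≤ ⟪g - X, N⟫) {κ : ℝ} (hκ : 0 < κ) :
    HasNegativeCaps μ K X (fun x => ⟪P (x - g), x - g⟫ - κ) ∨
      HasPositiveSpikes μ K X (fun x => ⟪P (x - g), x - g⟫ - κ) := by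
  set φ : E → ℝ := fun x => ⟪P (x - g), x - g⟫ - κ with hφdef
  have hφ : Continuous φ := by fun_prop
  set d := X - g with hd
  have hφz : ∀ z, φ (X + z) = φ X + 2 * ⟪P d, z⟫ + ⟪P z, z⟫ := by
    intro z
    have e : X + z - g = d + z := by rw [hd]; abel
    simp only [hφdef, e, ← hd, map_add, inner_add_left, inner_add_right, hP z d]
    rw [real_inner_comm z (P d)]
    ring
  set u : E → E := fun z => z + (-⟪z, N⟫) • N with hu
  have huN : ∀ z, ⟪u z, N⟫ = 0 := fun z => by
    rw [hu]; simp only; rw [h.form.inner_add_smul]; ring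
  have hTu : ∀ s z, parabolicDilation N s z = s • u z + (s ^ 2 * ⟪z, N⟫) • N := by
    intro s z
    rw [parabolicDilation_apply, hu]
    module
  have hexp : ∀ s z, φ (X + parabolicDilation N s z) = φ X + s * (2 * ⟪P d, u z⟫) +
      s ^ 2 * (⟪P (u z), u z⟫ + 2 * ⟪P d, N⟫ * ⟪z, N⟫) + s ^ 3 * (2 * ⟪z, N⟫ * ⟪P (u z), N⟫) +
      s ^ 4 * (⟪z, N⟫ ^ 2 * ⟪P N, N⟫) := by
    intro s z
    rw [hφz, hTu]
    simp only [map_add, map_smul, inner_add_left, inner_add_right, inner_smul_left,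
      inner_smul_right, RCLike.conj_to_real, hP N (u z)]
    rw [real_inner_comm N (P (u z))]
    ring
  have hucont : Continuous u := by fun_prop
  rcases lt_trichotomy (φ X) 0 with h0 | h0 | h0
  · left
    refine hasNegativeCaps_of_leading_term μ hE hK h hφ (k := 0) (by norm_num)
      (G := fun s z => φ (X + parabolicDilation N s z)) ?_ (fun s z => by simp) (v := 0)
      (by simp) ?_
    · simp only [parabolicDilation_apply]
      fun_prop
    · simpa [parabolicDilation_apply] using h0
  · by_cases hlin : ∀ v, ⟪v, N⟫ = 0 → ⟪P d, v⟫ = 0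
    · set β := ⟪P d, N⟫ with hβ
      -- Here φ(X) = 0 reads ⟨P d, d⟩ = κ > 0, and P d is normal, so ⟨d, N⟩ β > 0, while ⟨d, N⟩ ≤ 0
      -- because g is on the inner side.
      have hβneg : β < 0 := by
        have h1 : ⟪P d, d⟫ = κ := by
          have : φ X = ⟪P d, d⟫ - κ := rfl
          linarith
        have h2 : d = u d + ⟪d, N⟫ • N := by rw [hu]; module
        have h3 : ⟪P d, d⟫ = ⟪d, N⟫ * β := by
          refine (congrArg (fun y => ⟪P d, y⟫) h2).trans ?_
          rw [inner_add_right, hlin _ (huN d), inner_smul_right, zero_add]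
        have h4 : ⟪d, N⟫ ≤ 0 := by
          rw [hd, ← neg_sub, inner_neg_left]; linarith
        by_contra hβ0
        push Not at hβ0
        nlinarith
      set G : ℝ → E → ℝ := fun s z => (⟪P (u z), u z⟫ + 2 * β * ⟪z, N⟫) +
        s * (2 * ⟪z, N⟫ * ⟪P (u z), N⟫) + s ^ 2 * (⟪z, N⟫ ^ 2 * ⟪P N, N⟫) with hG
      have hGc : Continuous (Function.uncurry G) := by
        have : Function.uncurry G = fun q : ℝ × E => (⟪P (u q.2), u q.2⟫ + 2 * β * ⟪q.2, N⟫) +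
          q.1 * (2 * ⟪q.2, N⟫ * ⟪P (u q.2), N⟫) + q.1 ^ 2 * (⟪q.2, N⟫ ^ 2 * ⟪P N, N⟫) := rfl
        rw [this]
        fun_prop
      have hφG : ∀ s z, φ (X + parabolicDilation N s z) = s ^ 2 * G s z := by
        intro s z
        rw [hexp, h0, hlin _ (huN z), hG]
        ring
      -- This form is the leading term G 0 evaluated on the paraboloid w = B(v, v).
      by_cases hquad : ∀ v, ⟪v, N⟫ = 0 → 0 ≤ ⟪P v, v⟫ + 2 * β * B v v
      · right
        refine hasPositiveSpikes_of_leading_term μ hE hK h hφ le_rfl hGc hφG fun R =>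
          ⟨-(2 * β), by linarith, fun z _ => ?_⟩
        have h1 := hquad _ (huN z)
        rw [show B (u z) (u z) = B z z from h.form.apply_add_smul _ _] at h1
        simp only [hG, heightAbove]
        linarith
      · left
        push Not at hquad
        obtain ⟨v, hv, hneg⟩ := hquad
        refine hasNegativeCaps_of_leading_term μ hE hK h hφ le_rfl hGc hφG hv ?_
        have h1 : ⟪v + B v v • N, N⟫ = B v v := by rw [h.form.inner_add_smul, hv, zero_add]
        have h2 : u (v + B v v • N) = v := by rw [hu]; simp only [h1]; module
        simp only [hG, h1, h2]
        linarith
    · left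
      push Not at hlin
      obtain ⟨v, hv, hne⟩ : ∃ v, ⟪v, N⟫ = 0 ∧ ⟪P d, v⟫ < 0 := by
        obtain ⟨v, hv, hne⟩ := hlin
        rcases hne.lt_or_gt with hlt | hgt
        · exact ⟨v, hv, hlt⟩
        · exact ⟨-v, by rw [inner_neg_left, hv, neg_zero], by rw [inner_neg_right]; linarith⟩
      set G : ℝ → E → ℝ := fun s z => 2 * ⟪P d, u z⟫ +
        s * (⟪P (u z), u z⟫ + 2 * ⟪P d, N⟫ * ⟪z, N⟫) + s ^ 2 * (2 * ⟪z, N⟫ * ⟪P (u z), N⟫) +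
        s ^ 3 * (⟪z, N⟫ ^ 2 * ⟪P N, N⟫) with hG
      have hGc : Continuous (Function.uncurry G) := by
        have : Function.uncurry G = fun q : ℝ × E => 2 * ⟪P d, u q.2⟫ +
          q.1 * (⟪P (u q.2), u q.2⟫ + 2 * ⟪P d, N⟫ * ⟪q.2, N⟫) +
          q.1 ^ 2 * (2 * ⟪q.2, N⟫ * ⟪P (u q.2), N⟫) +
          q.1 ^ 3 * (⟪q.2, N⟫ ^ 2 * ⟪P N, N⟫) := rfl
        rw [this]
        fun_prop
      refine hasNegativeCaps_of_leading_term μ hE hK h hφ (k := 1) (by norm_num) hGc ?_ hv ?_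
      · intro s z
        rw [hexp, h0, hG]
        ring
      · have h1 : ⟪v + B v v • N, N⟫ = B v v := by rw [h.form.inner_add_smul, hv, zero_add]
        have h2 : u (v + B v v • N) = v := by rw [hu]; simp only [h1]; module
        simp only [hG, h2]
        linarith
  · right
    refine hasPositiveSpikes_of_leading_term μ hE hK h hφ (k := 0) (by norm_num)
      (G := fun s z => φ (X + parabolicDilation N s z)) ?_ (fun s z => by simp) fun R => ?_
    · simp only [parabolicDilation_apply]
      fun_prop
    · obtain ⟨M, hM⟩ := (isCompact_closedBall (0 : E) R).exists_bound_of_continuousOn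
        (IsTransverseForm.continuous_heightAbove (N := N) (B := B)).continuousOn
      refine ⟨φ X / (|M| + 1), by positivity, fun z hz => ?_⟩
      have h1 : parabolicDilation N 0 z = 0 := by simp [parabolicDilation_apply]
      rw [h1, add_zero]
      have h2 : |heightAbove N B z| ≤ |M| + 1 :=
        (hM z (mem_closedBall_zero_iff.mpr hz)).trans ((le_abs_self M).trans (by linarith))
      have h3 := (abs_le.mp h2).1
      have h4 := mul_le_mul_of_nonneg_left h3 (show 0 ≤ φ X / (|M| + 1) by positivity)
      have h5 : φ X / (|M| + 1) * (|M| + 1) = φ X := by field_simp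
      linarith

end Dichotomy

/-! ### Cutting and joining convex bodies. -/

section Bodies

variable {V : Type*} [NormedAddCommGroup V] [InnerProductSpace ℝ V]

/-- Cutting a small cap off a convex body. -/
lemma ConvexBody.exists_cut (K : ConvexBody V) (ℓ : V →L[ℝ] ℝ) (b : ℝ) {X : V} {ρ : ℝ}
    (hρ : 0 < ρ) (hsub : (K : Set V) ∩ {x | ℓ x < b} ⊆ Metric.ball X ρ) {k₀ : V} (hk₀ : k₀ ∈ K)
    (hk₀X : ρ < ‖k₀ - X‖) :
    ∃ K' : ConvexBody V, (K' : Set V) = (K : Set V) ∩ {x | b ≤ ℓ x} ∧ dist K' K ≤ 2 * ρ ∧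
      ∀ k ∈ interior (K : Set V), ρ < ‖k - X‖ → k ∈ interior (K' : Set V) := by
  have hfar : ∀ k ∈ K, ρ ≤ ‖k - X‖ → b ≤ ℓ k := by
    intro k hk hkX
    by_contra hlt
    push Not at hlt
    have := mem_ball_iff_norm.mp (hsub ⟨hk, hlt⟩)
    linarith
  have hconv : Convex ℝ ((K : Set V) ∩ {x | b ≤ ℓ x}) :=
    K.convex.inter ((convex_halfSpace_ge ℓ.isLinear b))
  have hcomp : IsCompact ((K : Set V) ∩ {x | b ≤ ℓ x}) :=
    K.isCompact.inter_right (isClosed_le continuous_const ℓ.continuous)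
  refine ⟨⟨(K : Set V) ∩ {x | b ≤ ℓ x}, hconv, hcomp, ⟨k₀, hk₀, hfar k₀ hk₀ hk₀X.le⟩⟩, rfl, ?_, ?_⟩
  · rw [← ConvexBody.hausdorffDist_coe]
    refine Metric.hausdorffDist_le_of_mem_dist (by positivity)
      (fun x hx => ⟨x, hx.1, by simp; positivity⟩) fun x hx => ?_
    by_cases hxb : b ≤ ℓ x
    · exact ⟨x, ⟨hx, hxb⟩, by simp; positivity⟩
    · have hxX := hsub ⟨hx, not_le.mp hxb⟩
      rw [mem_ball_iff_norm] at hxX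
      -- A removed point is approximated by the point where its segment to k₀ crosses the sphere of
      -- radius ρ about X, which survives the cut.
      obtain ⟨y, hy, hyρ⟩ := (convex_segment x k₀).isPreconnected.intermediate_value
        (left_mem_segment ℝ _ _) (right_mem_segment ℝ _ _) (f := fun y => ‖y - X‖)
        (Continuous.continuousOn (by fun_prop)) ⟨hxX.le, hk₀X.le⟩
      have hyK : y ∈ K := K.convex.segment_subset hx hk₀ hy
      refine ⟨y, ⟨hyK, hfar y hyK hyρ.ge⟩, ?_⟩
      have h1 := dist_triangle_right x y X
      rw [dist_eq_norm x X, dist_eq_norm y X] at h1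
      simp only at hyρ
      linarith
  · intro k hk hkX
    have ho : IsOpen (interior (K : Set V) ∩ {x | ρ < ‖x - X‖}) :=
      isOpen_interior.inter (isOpen_lt continuous_const (by fun_prop))
    refine interior_maximal ?_ ho ⟨hk, hkX⟩
    rintro x ⟨hx, hxX⟩
    exact ⟨interior_subset hx, hfar x (interior_subset hx) (le_of_lt hxX)⟩

/-- Adding a point to a convex body. -/
lemma ConvexBody.exists_join (K : ConvexBody V) {X : V} (hX : X ∈ K) (p : V) :
    ∃ K' : ConvexBody V, (K' : Set V) = convexJoin ℝ {p} (K : Set V) ∧ dist K' K ≤ ‖p - X‖ := by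
  have hsub : (K : Set V) ⊆ convexJoin ℝ {p} (K : Set V) := subset_convexJoin_right (by simp)
  refine ⟨⟨convexJoin ℝ {p} (K : Set V), (convex_singleton p).convexJoin K.convex,
    K.isCompact.convexJoin_singleton p, ⟨X, hsub hX⟩⟩, rfl, ?_⟩
  rw [← ConvexBody.hausdorffDist_coe]
  refine Metric.hausdorffDist_le_of_mem_dist (norm_nonneg _) (fun x hx => ?_)
    fun x hx => ⟨x, hsub hx, by simp⟩
  obtain ⟨p', hp', k, hk, a, b, ha, hb, hab, rfl⟩ := mem_convexJoin.mp hx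
  rw [Set.mem_singleton_iff] at hp'
  subst hp'
  -- Replacing the apex by X moves the combination by a ‖p - X‖.
  refine ⟨a • X + b • k, K.convex hX hk ha hb hab, ?_⟩
  rw [dist_eq_norm, add_sub_add_right_eq_sub, ← smul_sub, norm_smul, Real.norm_of_nonneg ha]
  have : a ≤ 1 := by linarith
  nlinarith [norm_nonneg (p' - X)]

/-- Joining a symmetric convex set to a pair of symmetric points. -/
lemma Convex.convexJoin_reflect_eq_union {K : Set V} (hK : Convex ℝ K) {c : V} (hc : c ∈ K)
    (p : V) : convexJoin ℝ {(2 : ℝ) • c - p} (convexJoin ℝ {p} K) =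
      convexJoin ℝ {p} K ∪ convexJoin ℝ {(2 : ℝ) • c - p} K := by
  have hne : K.Nonempty := ⟨c, hc⟩
  have hsubK : ∀ q : V, K ⊆ convexJoin ℝ {q} K := fun q => subset_convexJoin_right (by simp)
  have hthree : ∀ (q k : V) (a b e : ℝ), k ∈ K → 0 ≤ a → 0 ≤ b → 0 ≤ e → a + b + e = 1 →
      a • q + b • c + e • k ∈ convexJoin ℝ {q} K := by
    intro q k a b e hk ha hb he hab
    have hconv := (convex_singleton (𝕜 := ℝ) q).convexJoin hK
    have hq : q ∈ convexJoin ℝ {q} K := subset_convexJoin_left hne rfl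
    have := hconv.sum_mem (t := Finset.univ) (w := ![a, b, e]) (z := ![q, c, k])
      (by intro i _; fin_cases i <;> simpa) (by simpa [Fin.sum_univ_three] using hab)
      (by intro i _; fin_cases i; exacts [hq, hsubK q hc, hsubK q hk])
    simpa [Fin.sum_univ_three] using this
  apply Set.Subset.antisymm
  · intro x hx
    obtain ⟨q, hq, y, hy, l, m', hl, hm', hlm, rfl⟩ := mem_convexJoin.mp hx
    rw [Set.mem_singleton_iff] at hq
    obtain ⟨q', hq', k, hk, m, e, hm, he, hme, rfl⟩ := mem_convexJoin.mp hy
    rw [Set.mem_singleton_iff] at hq'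
    subst hq hq'
    have hm'm : 0 ≤ m' * m := by positivity
    have hm'e : 0 ≤ m' * e := by positivity
    have hsum : l + m' * m + m' * e = 1 := by
      rw [add_assoc, ← mul_add, hme, mul_one, hlm]
    -- Equal weights on p and 2c - p merge into weight on c ∈ K; the sign of l - m' m tells which
    -- apex is left.
    rcases le_total l (m' * m) with hle | hle
    · left
      have := hthree q' k (m' * m - l) (2 * l) (m' * e) hk (by linarith) (by linarith) hm'e
        (by linarith)
      convert this using 1
      module
    · right
      have := hthree ((2 : ℝ) • c - q') k (l - m' * m) (2 * (m' * m)) (m' * e) hk (by linarith)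
        (by linarith) hm'e (by linarith)
      convert this using 1
      module
  · rintro x (hx | hx)
    · exact subset_convexJoin_right (by simp) hx
    · exact convexJoin_mono_right (hsubK p) hx

end Bodies

/-! ### From the curvature condition to an osculating form. -/

section Curvature

variable {n : ℕ}

/-- B is the polar form of q pulled back by the orthogonal projection to N^⊥, and translation puts X
at the origin. -/
lemma HasPositiveGeneralizedCurvatureAt.exists_isOsculated
    {K : ConvexBody (EuclideanSpace ℝ (Fin n))} (hK : K ∈ properBodies n)
    {X : EuclideanSpace ℝ (Fin n)} (h : HasPositiveGeneralizedCurvatureAt K X) :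
    ∃ (N : EuclideanSpace ℝ (Fin n))
      (B : EuclideanSpace ℝ (Fin n) →L[ℝ] EuclideanSpace ℝ (Fin n) →L[ℝ] ℝ),
      (∀ x ∈ K, 0 ≤ ⟪x - X, N⟫) ∧
        IsOsculated N B ((fun z => X + z) ⁻¹' (K : Set (EuclideanSpace ℝ (Fin n)))) := by
  obtain ⟨hX, N, ⟨hN1, hN⟩, q, hq, hcurv⟩ := h
  have hNN : ⟪N, N⟫ = 1 := by rw [real_inner_self_eq_norm_sq, hN1, one_pow]
  have hmem : ∀ z, z - ⟪z, N⟫ • N ∈ (ℝ ∙ N)ᗮ := by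
    intro z
    rw [Submodule.mem_orthogonal_singleton_iff_inner_left, inner_sub_left, inner_smul_left, hNN]
    simp
  let π : EuclideanSpace ℝ (Fin n) →ₗ[ℝ] (ℝ ∙ N)ᗮ :=
    { toFun := fun z => ⟨z - ⟪z, N⟫ • N, hmem z⟩
      map_add' := fun x y => by
        ext1
        simp only [inner_add_left, Submodule.coe_add]
        module
      map_smul' := fun a x => by
        ext1
        simp only [inner_smul_left, Submodule.coe_smul, RCLike.conj_to_real, RingHom.id_apply]
        module }
  have hπ : ∀ z, ((π z : (ℝ ∙ N)ᗮ) : EuclideanSpace ℝ (Fin n)) = z - ⟪z, N⟫ • N := fun z => rfl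
  have hπN : π N = 0 := by
    ext1
    rw [hπ, hNN]
    simp
  set B := ((QuadraticMap.associated (R := ℝ) q).compl₁₂ π π).toContinuousBilinearMap with hB
  have hBz : ∀ z, B z z = q (π z) := fun z => QuadraticMap.associated_eq_self_apply ℝ q (π z)
  set e := Homeomorph.addLeft X with he
  have hform : IsTransverseForm N B :=
    { norm_eq := hN1
      symm := fun x y => by
        change QuadraticMap.associated (R := ℝ) q (π x) (π y) =
          QuadraticMap.associated (R := ℝ) q (π y) (π x)
        exact QuadraticMap.associated_isSymm ℝ q _ _
      apply_normal := fun x => by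
        change QuadraticMap.associated (R := ℝ) q (π x) (π N) = 0
        rw [hπN, map_zero]
      pos := fun x hx hx0 => by
        rw [hBz]
        refine hq _ fun h0 => hx0 ?_
        have := congrArg (Subtype.val) h0
        rw [hπ, hx] at this
        simpa using this }
  refine ⟨N, B, hN, hform, K.convex.translate_preimage_right X, K.isClosed.preimage e.continuous,
    ?_, ?_, fun z hz => ?_, fun ε hε => ?_⟩
  · change (interior (e ⁻¹' _)).Nonempty
    rw [← e.preimage_interior]
    exact hK.preimage e.surjective
  · change X + 0 ∈ (K : Set _)
    rw [add_zero]
    exact K.isClosed.frontier_subset hX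
  · simpa using hN _ hz
  · obtain ⟨a, ha, hfr⟩ := hcurv ε hε
    refine ⟨a, ha, fun z hz hza => ?_⟩
    change z ∈ frontier (e ⁻¹' _) at hz
    rw [← e.preimage_frontier] at hz
    rw [hBz]
    apply hfr
    rw [hπ]
    have : X + (z - ⟪z, N⟫ • N) + ⟪z, N⟫ • N = X + z := by abel
    rw [this]
    exact ⟨hz, by simpa using hza⟩

end Curvature

/-! ### Contradiction with local maximality. -/

section LocalMaximizers

variable {n : ℕ}

/-- A local maximizer admits no perturbations of small volume which increase the integral of the
first variation by too much. -/
lemma not_eventually_perturbation (hn : 2 ≤ n) {K : ConvexBody (EuclideanSpace ℝ (Fin n))}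
    (hK : K ∈ properBodies n) {𝒞 : Set (ConvexBody (EuclideanSpace ℝ (Fin n)))}
    (h𝒞 : 𝒞 ⊆ properBodies n) (hmax : IsLocalMaxOn isotropyConstant 𝒞 K) {c C : ℝ} (hc : 0 < c)
    (hC : 0 < C) :
    ¬ ∀ᶠ s in nhdsWithin (0 : ℝ) (Set.Ioi 0), ∃ K' ∈ 𝒞, dist K' K ≤ C * s ∧
      volume.real ((K : Set (EuclideanSpace ℝ (Fin n))) \ K') +
        volume.real ((K' : Set (EuclideanSpace ℝ (Fin n))) \ K) ≤ C * s ^ (n + 1) ∧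
      c * s ^ (n + 3) ≤ (∫ x in (K' : Set (EuclideanSpace ℝ (Fin n))), firstVariation K x) -
        (∫ x in (K : Set (EuclideanSpace ℝ (Fin n))), firstVariation K x) := by
  intro hev
  obtain ⟨r, hr, hball⟩ := Metric.mem_nhdsWithin_iff.mp hmax
  set g := centroidOf (K : Set (EuclideanSpace ℝ (Fin n))) with hg
  obtain ⟨R, hR⟩ := (K.isCompact.image (f := fun x => x - g) (by fun_prop)).isBounded.exists_norm_le
  obtain ⟨c₁, δ₀, hc₁, hδ₀, hpert⟩ := exists_isotropyConstant_lt_of_perturbation hn hK (R + 1)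
  have hlim : ∀ f : ℝ → ℝ, Continuous f → f 0 = 0 →
      Filter.Tendsto f (nhdsWithin 0 (Set.Ioi 0)) (nhds 0) := fun f hf h0 => by
    have := (hf.tendsto 0).mono_left (nhdsWithin_le_nhds (s := Set.Ioi 0))
    rwa [h0] at this
  have hlt1 : ∀ᶠ s in nhdsWithin (0 : ℝ) (Set.Ioi 0), s < 1 :=
    nhdsWithin_le_nhds (gt_mem_nhds one_pos)
  obtain ⟨s, ⟨⟨⟨⟨K', hK'𝒞, hdist, hvol, hgain⟩, hs1⟩, hs2⟩, hs3⟩, hs4, hs0⟩ :=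
    ((((hev.and ((hlim (fun s => C * s) (by fun_prop) (by simp)).eventually
      (gt_mem_nhds (lt_min hr one_pos)))).and
      ((hlim (fun s => C * s ^ (n + 1)) (by fun_prop) (by simp)).eventually
      (gt_mem_nhds hδ₀))).and
      ((hlim (fun s => c₁ * C ^ 2 * s) (by fun_prop) (by simp)).eventually
      (gt_mem_nhds hc))).and
      (hlt1.and self_mem_nhdsWithin)).exists
  replace hs0 : 0 < s := hs0
  have hd := hdist.trans_lt hs1
  have hle : isotropyConstant K' ≤ isotropyConstant K :=
    hball ⟨Metric.mem_ball.mpr (hd.trans_le (min_le_left _ _)), hK'𝒞⟩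
  refine absurd (hpert K' (h𝒞 hK'𝒞) ?_ (C * s ^ (n + 1)) hvol hs2.le ?_) (not_lt.mpr hle)
  · intro x hx
    have h1 : Metric.hausdorffDist (K' : Set (EuclideanSpace ℝ (Fin n))) K < 1 := by
      rw [ConvexBody.hausdorffDist_coe]
      exact hd.trans_le (min_le_right _ _)
    obtain ⟨y, hy, hxy⟩ := Metric.exists_dist_lt_of_hausdorffDist_lt hx h1
      ConvexBody.hausdorffEDist_ne_top
    have h2 := hR _ ⟨y, hy, rfl⟩
    have h3 : ‖x - g‖ ≤ ‖x - y‖ + ‖y - g‖ := by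
      have := norm_add_le (x - y) (y - g)
      rwa [sub_add_sub_cancel] at this
    rw [dist_eq_norm] at hxy
    linarith
  · refine lt_of_lt_of_le ?_ hgain
    -- n ≥ 2 is needed here: the squared volume has an extra factor s compared with the gain s ^ (n
    -- + 3).
    have h1 : s ^ (2 * n + 2) ≤ s ^ (n + 4) := pow_le_pow_of_le_one hs0.le hs4.le (by omega)
    calc c₁ * (C * s ^ (n + 1)) ^ 2 = c₁ * C ^ 2 * s ^ (2 * n + 2) := by ring
      _ ≤ c₁ * C ^ 2 * s ^ (n + 4) := mul_le_mul_of_nonneg_left h1 (by positivity)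
      _ = c₁ * C ^ 2 * s * s ^ (n + 3) := by ring
      _ < c * s ^ (n + 3) := mul_lt_mul_of_pos_right hs3 (by positivity)

lemma hasNegativeCaps_or_hasPositiveSpikes_firstVariation (hn : 2 ≤ n)
    {K : ConvexBody (EuclideanSpace ℝ (Fin n))} (hK : K ∈ properBodies n)
    {X : EuclideanSpace ℝ (Fin n)} (h : HasPositiveGeneralizedCurvatureAt K X) :
    HasNegativeCaps volume (K : Set (EuclideanSpace ℝ (Fin n))) X (firstVariation K) ∨
      HasPositiveSpikes volume (K : Set (EuclideanSpace ℝ (Fin n))) X (firstVariation K) := by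
  obtain ⟨N, B, hN, hosc⟩ := h.exists_isOsculated hK
  set S := (K : Set (EuclideanSpace ℝ (Fin n))) with hS
  have hV : 0 < volume.real S := measureReal_pos_of_interior K.isCompact hK
  set P := LinearMap.toContinuousLinearMap (Matrix.toEuclideanLin (inertia S)⁻¹) with hP
  refine hasNegativeCaps_or_hasPositiveSpikes volume (by simp; omega) K.isCompact hosc (P := P)
    ?_ (g := centroidOf S) ?_ (κ := ((n : ℝ) + 2) / volume.real S) (by positivity)
  · exact Matrix.isSymmetric_toEuclideanLin_iff.mpr (inertia_posDef K.isCompact hK).inv.isHermitian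
  -- The centroid, as an average over K, lies in the supporting half-space at X.
  · have h0 := setIntegral_inner_sub_centroidOf K.isCompact hK N
    have h1 : ∫ x in S, ⟪x - X, N⟫ = volume.real S * ⟪centroidOf S - X, N⟫ := by
      have e : (fun x : EuclideanSpace ℝ (Fin n) => ⟪x - X, N⟫) =
          fun x => ⟪x - centroidOf S, N⟫ + ⟪centroidOf S - X, N⟫ := by
        funext x
        rw [← inner_add_left, sub_add_sub_cancel]
      rw [e, integral_add ((Continuous.continuousOn (by fun_prop)).integrableOn_compact
        K.isCompact) ((Continuous.continuousOn (by fun_prop)).integrableOn_compact K.isCompact),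
        setIntegral_const, smul_eq_mul]
      rw [h0, zero_add]
    have h2 : 0 ≤ ∫ x in S, ⟪x - X, N⟫ :=
      setIntegral_nonneg K.isCompact.measurableSet fun x hx => hN x hx
    rw [h1] at h2
    exact nonneg_of_mul_nonneg_right h2 hV

lemma ne_of_mem_interior_frontier {S : Set (EuclideanSpace ℝ (Fin n))}
    {k X : EuclideanSpace ℝ (Fin n)} (hk : k ∈ interior S) (hX : X ∈ frontier S) :
    0 < ‖k - X‖ := by
  rw [norm_pos_iff, sub_ne_zero]
  rintro rfl
  exact hX.2 hk

lemma eventually_mul_lt {C a : ℝ} (ha : 0 < a) :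
    ∀ᶠ s in nhdsWithin (0 : ℝ) (Set.Ioi 0), C * s < a := by
  have : Filter.Tendsto (fun s : ℝ => C * s) (nhdsWithin 0 (Set.Ioi 0)) (nhds 0) := by
    have h1 : Continuous fun s : ℝ => C * s := by fun_prop
    simpa using (h1.tendsto 0).mono_left nhdsWithin_le_nhds
  exact this.eventually (gt_mem_nhds ha)

lemma not_isLocalMaxOn_of_curvature (hn : 2 ≤ n) {K : ConvexBody (EuclideanSpace ℝ (Fin n))}
    (hK : K ∈ properBodies n) {X : EuclideanSpace ℝ (Fin n)}
    (h : HasPositiveGeneralizedCurvatureAt K X) :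
    ¬ IsLocalMaxOn isotropyConstant (properBodies n) K := by
  intro hmax
  obtain ⟨k₀, hk₀⟩ := id hK
  have hXf := h.1
  have hkX := ne_of_mem_interior_frontier hk₀ hXf
  have hφi : ∀ T : Set (EuclideanSpace ℝ (Fin n)), IsCompact T →
      IntegrableOn (firstVariation (K : Set (EuclideanSpace ℝ (Fin n)))) T := fun T hT =>
    (firstVariation_continuous _).continuousOn.integrableOn_compact hT
  rcases hasNegativeCaps_or_hasPositiveSpikes_firstVariation hn hK h with
    ⟨c, C, hc, hC, hev⟩ | ⟨c, C, hc, hC, hev⟩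
  -- A cut inside a ball of radius C s moves the body by at most 2 C s.
  · refine not_eventually_perturbation hn hK subset_rfl hmax hc (C := 2 * C) (by positivity) ?_
    filter_upwards [hev, eventually_mul_lt (C := C) hkX, self_mem_nhdsWithin] with s hs hsk hs0
    replace hs0 : 0 < s := hs0
    obtain ⟨ℓ, b, hsub, hvol, hint⟩ := hs
    rw [finrank_euclideanSpace_fin] at hvol hint
    obtain ⟨K', hK', hd, hi⟩ := K.exists_cut ℓ b (by positivity) hsub (interior_subset hk₀) hsk
    have hdiff : (K : Set (EuclideanSpace ℝ (Fin n))) \ K' =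
        (K : Set (EuclideanSpace ℝ (Fin n))) ∩ {x | ℓ x < b} := by
      rw [hK']; ext x; simp
    have hdiff' : (K' : Set (EuclideanSpace ℝ (Fin n))) \ K = ∅ := by
      rw [hK', Set.sdiff_eq_empty]; exact Set.inter_subset_left
    refine ⟨K', ⟨k₀, hi k₀ hk₀ hsk⟩, by linarith, ?_, ?_⟩
    · rw [hdiff, hdiff', measureReal_empty, add_zero]
      have : 0 < C * s ^ (n + 1) := by positivity
      linarith
    · have h1 := integral_inter_add_sdiff (μ := volume)
        (s := (K : Set (EuclideanSpace ℝ (Fin n)))) K'.isCompact.measurableSet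
        (hφi _ K.isCompact)
      rw [hdiff, Set.inter_eq_right.mpr (hK' ▸ Set.inter_subset_left)] at h1
      linarith
  · refine not_eventually_perturbation hn hK subset_rfl hmax hc hC ?_
    filter_upwards [hev] with s hs
    obtain ⟨p, hp, -, hvol, hint⟩ := hs
    rw [finrank_euclideanSpace_fin] at hvol hint
    obtain ⟨K', hK', hd⟩ := K.exists_join (K.isClosed.frontier_subset hXf) p
    have hsubK : (K : Set (EuclideanSpace ℝ (Fin n))) ⊆ K' :=
      hK' ▸ subset_convexJoin_right (by simp)
    refine ⟨K', ⟨k₀, interior_mono hsubK hk₀⟩, hd.trans hp, ?_, ?_⟩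
    · rw [Set.sdiff_eq_empty.mpr hsubK, measureReal_empty, zero_add, hK']
      exact hvol
    · have h1 := integral_inter_add_sdiff (μ := volume)
        (s := (K' : Set (EuclideanSpace ℝ (Fin n)))) K.isCompact.measurableSet
        (hφi _ K'.isCompact)
      rw [Set.inter_eq_right.mpr hsubK] at h1
      rw [← hK'] at hint
      linarith

/-! ### The centrally symmetric case. -/

section Symmetric

variable {K : ConvexBody (EuclideanSpace ℝ (Fin n))} {c : EuclideanSpace ℝ (Fin n)}

lemma measurePreserving_reflect (c : EuclideanSpace ℝ (Fin n)) :
    MeasurePreserving (fun x => (2 : ℝ) • c - x) volume volume :=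
  Measure.measurePreserving_sub_left volume _

lemma measurableEmbedding_reflect (c : EuclideanSpace ℝ (Fin n)) :
    MeasurableEmbedding (fun x => (2 : ℝ) • c - x) :=
  (MeasurableEquiv.subLeft ((2 : ℝ) • c)).measurableEmbedding

lemma IsSymmetricAbout.preimage_eq (h : IsSymmetricAbout c K) :
    (fun x => (2 : ℝ) • c - x) ⁻¹' (K : Set (EuclideanSpace ℝ (Fin n))) = K := by
  ext x
  refine ⟨fun hx => ?_, fun hx => h x hx⟩
  have := h _ hx
  rwa [sub_sub_cancel] at this

lemma IsSymmetricAbout.mem_interior (h : IsSymmetricAbout c K) {x : EuclideanSpace ℝ (Fin n)}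
    (hx : x ∈ interior (K : Set (EuclideanSpace ℝ (Fin n)))) :
    (2 : ℝ) • c - x ∈ interior (K : Set (EuclideanSpace ℝ (Fin n))) := by
  have h1 := (Homeomorph.subLeft ((2 : ℝ) • c)).preimage_interior
    (K : Set (EuclideanSpace ℝ (Fin n)))
  have h2 : (Homeomorph.subLeft ((2 : ℝ) • c)) ⁻¹' (K : Set (EuclideanSpace ℝ (Fin n))) = K :=
    h.preimage_eq
  rw [h2] at h1
  rw [← h1] at hx
  exact hx

lemma IsSymmetricAbout.center_mem_interior (hK : K ∈ properBodies n) (h : IsSymmetricAbout c K) :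
    c ∈ interior (K : Set (EuclideanSpace ℝ (Fin n))) := by
  obtain ⟨k, hk⟩ := id hK
  have := K.convex.interior hk (h.mem_interior hk) (a := 1 / 2) (b := 1 / 2) (by norm_num)
    (by norm_num) (by norm_num)
  convert this using 1
  module

lemma IsSymmetricAbout.centroidOf_eq (hK : K ∈ properBodies n) (h : IsSymmetricAbout c K) :
    centroidOf (K : Set (EuclideanSpace ℝ (Fin n))) = c := by
  have hV := measureReal_pos_of_interior K.isCompact hK
  have h1 := (measurePreserving_reflect c).setIntegral_preimage_emb (measurableEmbedding_reflect c)
    (fun x => x) (K : Set (EuclideanSpace ℝ (Fin n)))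
  rw [h.preimage_eq, integral_sub (f := fun _ => (2 : ℝ) • c) (g := fun x => x)
    (continuous_const.continuousOn.integrableOn_compact K.isCompact)
    (continuous_id.continuousOn.integrableOn_compact K.isCompact), setIntegral_const] at h1
  set I := ∫ x in (K : Set (EuclideanSpace ℝ (Fin n))), x with hI
  have h2 : I = volume.real (K : Set (EuclideanSpace ℝ (Fin n))) • c := by
    have h3 : (2 : ℝ) • I = (2 : ℝ) • (volume.real (K : Set (EuclideanSpace ℝ (Fin n))) • c) := by
      rw [two_smul ℝ I, smul_comm (2 : ℝ)]
      exact (sub_eq_iff_eq_add.mp h1).symm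
    exact smul_right_injective _ two_ne_zero h3
  rw [centroidOf, ← hI, h2, smul_smul, inv_mul_cancel₀ hV.ne', one_smul]

lemma IsSymmetricAbout.firstVariation_reflect (hK : K ∈ properBodies n)
    (h : IsSymmetricAbout c K) (x : EuclideanSpace ℝ (Fin n)) :
    firstVariation (K : Set (EuclideanSpace ℝ (Fin n))) ((2 : ℝ) • c - x) =
      firstVariation (K : Set (EuclideanSpace ℝ (Fin n))) x := by
  have e : (2 : ℝ) • c - x - c = -(x - c) := by module
  rw [firstVariation, firstVariation, h.centroidOf_eq hK, e, map_neg, inner_neg_neg]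

/-- The radius condition makes D and its reflection disjoint, so the two contributions add without
interference. -/
lemma setIntegral_union_reflect {φ : EuclideanSpace ℝ (Fin n) → ℝ}
    (hφ : ∀ x, φ ((2 : ℝ) • c - x) = φ x) {D : Set (EuclideanSpace ℝ (Fin n))}
    (hDm : MeasurableSet D) (hint : IntegrableOn φ D)
    {X : EuclideanSpace ℝ (Fin n)} {r : ℝ} (hD : D ⊆ Metric.ball X r)
    (hr : 2 * r < ‖X - ((2 : ℝ) • c - X)‖) :
    ∫ x in D ∪ (fun x => (2 : ℝ) • c - x) ⁻¹' D, φ x = 2 * ∫ x in D, φ x ∧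
      volume.real (D ∪ (fun x => (2 : ℝ) • c - x) ⁻¹' D) ≤ 2 * volume.real D := by
  set σ : EuclideanSpace ℝ (Fin n) → EuclideanSpace ℝ (Fin n) := fun x => (2 : ℝ) • c - x with hσ
  have hmp := measurePreserving_reflect c
  have hemb := measurableEmbedding_reflect c
  have hdisj : Disjoint D (σ ⁻¹' D) := by
    rw [Set.disjoint_left]
    intro x hx hx'
    have h1 := mem_ball_iff_norm.mp (hD hx)
    have h2 := mem_ball_iff_norm.mp (hD hx')
    have h3 : X - ((2 : ℝ) • c - X) = -((x - X) + (σ x - X)) := by rw [hσ]; module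
    have h4 := norm_add_le (x - X) (σ x - X)
    rw [h3, norm_neg] at hr
    linarith
  have hpre : ∀ x, φ (σ x) = φ x := hφ
  have h1 := hmp.setIntegral_preimage_emb hemb φ D
  have hint' : IntegrableOn φ (σ ⁻¹' D) := by
    have := (hmp.integrableOn_comp_preimage hemb (f := φ) (s := D)).mpr hint
    refine this.congr_fun (fun x _ => hpre x) (hemb.measurable hDm)
  have h2 : volume (σ ⁻¹' D) = volume D := hmp.measure_preimage hDm.nullMeasurableSet
  constructor
  · rw [setIntegral_union hdisj (hemb.measurable hDm) hint hint', two_mul]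
    congr 1
    rw [← h1]
    exact integral_congr_ae (.of_forall fun x => (hpre x).symm)
  · refine (measureReal_union_le _ _).trans (le_of_eq ?_)
    rw [measureReal_def, measureReal_def, h2, two_mul]

lemma mem_convexJoin_reflect (h : IsSymmetricAbout c K) {q x : EuclideanSpace ℝ (Fin n)}
    (hx : x ∈ convexJoin ℝ {q} (K : Set (EuclideanSpace ℝ (Fin n)))) :
    (2 : ℝ) • c - x ∈ convexJoin ℝ {(2 : ℝ) • c - q} (K : Set (EuclideanSpace ℝ (Fin n))) := by
  obtain ⟨p, hp, k, hk, a, b, ha, hb, hab, rfl⟩ := mem_convexJoin.mp hx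
  rw [Set.mem_singleton_iff] at hp
  subst hp
  refine mem_convexJoin.mpr ⟨_, rfl, _, h k hk, a, b, ha, hb, hab, ?_⟩
  obtain rfl : a = 1 - b := by linarith
  module

lemma not_isLocalMaxOn_symmetric_of_curvature (hn : 2 ≤ n) (hK : K ∈ properBodies n)
    (hsym : IsSymmetricAbout c K) {X : EuclideanSpace ℝ (Fin n)}
    (h : HasPositiveGeneralizedCurvatureAt K X) :
    ¬ IsLocalMaxOn isotropyConstant {K' ∈ properBodies n | IsSymmetricAbout c K'} K := by
  intro hmax
  obtain ⟨k₀, hk₀⟩ := id hK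
  have hXf := h.1
  have hXK : X ∈ K := K.isClosed.frontier_subset hXf
  set X' := (2 : ℝ) • c - X with hX'
  have hkX := ne_of_mem_interior_frontier hk₀ hXf
  have hkX' : 0 < ‖k₀ - X'‖ := by
    have := ne_of_mem_interior_frontier (hsym.mem_interior hk₀) hXf
    rwa [show (2 : ℝ) • c - k₀ - X = -(k₀ - X') by rw [hX']; module, norm_neg] at this
  -- The centre is an interior point, so a boundary point differs from its reflection.
  have hXX' : 0 < ‖X - X'‖ / 2 := by
    have := ne_of_mem_interior_frontier (hsym.center_mem_interior hK) hXf
    rw [show X - X' = -((2 : ℝ) • (c - X)) by rw [hX']; module, norm_neg, norm_smul]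
    norm_num
    exact norm_pos_iff.mp this
  have hφi : ∀ T : Set (EuclideanSpace ℝ (Fin n)), IsCompact T →
      IntegrableOn (firstVariation (K : Set (EuclideanSpace ℝ (Fin n)))) T := fun T hT =>
    (firstVariation_continuous _).continuousOn.integrableOn_compact hT
  have hφσ := hsym.firstVariation_reflect hK
  rcases hasNegativeCaps_or_hasPositiveSpikes_firstVariation hn hK h with
    ⟨γ, C, hγ, hC, hev⟩ | ⟨γ, C, hγ, hC, hev⟩
  -- Two opposite cuts, each of Hausdorff cost at most 2 C s, and twice the gain.
  · refine not_eventually_perturbation hn hK (fun _ h => h.1) hmax (c := 2 * γ) (C := 4 * C)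
      (by positivity) (by positivity) ?_
    filter_upwards [hev, eventually_mul_lt (C := C) hkX, eventually_mul_lt (C := C) hkX', eventually_mul_lt (C := C) hXX',
      self_mem_nhdsWithin] with s hs hsk hsk' hsX hs0
    replace hs0 : 0 < s := hs0
    obtain ⟨ℓ, b, hsub, hvol, hint⟩ := hs
    rw [finrank_euclideanSpace_fin] at hvol hint
    obtain ⟨K₁, hK₁, hd₁, hi₁⟩ := K.exists_cut ℓ b (by positivity) hsub (interior_subset hk₀) hsk
    set D := (K : Set (EuclideanSpace ℝ (Fin n))) ∩ {x | ℓ x < b} with hD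
    have hD' : (fun x => (2 : ℝ) • c - x) ⁻¹' D =
        (K : Set (EuclideanSpace ℝ (Fin n))) ∩ {x | (-ℓ) x < b - ℓ ((2 : ℝ) • c)} := by
      rw [hD, Set.preimage_inter, hsym.preimage_eq]
      congr 1
      ext x
      change ℓ ((2 : ℝ) • c - x) < b ↔ -(ℓ x) < b - ℓ ((2 : ℝ) • c)
      rw [map_sub]
      constructor <;> intro h <;> linarith
    have hDball : (fun x => (2 : ℝ) • c - x) ⁻¹' D ⊆ Metric.ball X' (C * s) := by
      intro x hx
      have h1 := mem_ball_iff_norm.mp (hsub hx)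
      rw [mem_ball_iff_norm]
      rwa [show (2 : ℝ) • c - x - X = -(x - X') by rw [hX']; module, norm_neg] at h1
    obtain ⟨K₂, hK₂, hd₂, hi₂⟩ := K₁.exists_cut (-ℓ) (b - ℓ ((2 : ℝ) • c)) (by positivity)
      (by
        refine Set.Subset.trans ?_ hDball
        rw [hD', hK₁]
        exact Set.inter_subset_inter_left _ Set.inter_subset_left)
      (interior_subset (hi₁ k₀ hk₀ hsk)) hsk'
    rw [hK₁] at hK₂
    have hsubK : (K₂ : Set (EuclideanSpace ℝ (Fin n))) ⊆ K := by
      rw [hK₂]; exact Set.inter_subset_left.trans Set.inter_subset_left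
    have hdiff : (K : Set (EuclideanSpace ℝ (Fin n))) \ K₂ =
        D ∪ (fun x => (2 : ℝ) • c - x) ⁻¹' D := by
      rw [hD', hK₂, hD, ← Set.inter_union_distrib_left]
      ext x
      simp only [Set.mem_sdiff, Set.mem_inter_iff, Set.mem_union, Set.mem_ofPred_eq]
      rw [← not_le, ← not_le]
      tauto
    have hDm : MeasurableSet D :=
      K.isCompact.measurableSet.inter (isOpen_lt ℓ.continuous continuous_const).measurableSet
    obtain ⟨hI, hv⟩ := setIntegral_union_reflect hφσ hDm
      ((hφi _ K.isCompact).mono_set Set.inter_subset_left)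
      hsub
      (by rw [← hX']; linarith)
    rw [← hdiff] at hI hv
    refine ⟨K₂, ⟨⟨k₀, hi₂ k₀ (hi₁ k₀ hk₀ hsk) hsk'⟩, fun x hx => ?_⟩, ?_, ?_, ?_⟩
    · have hx2 : x ∈ (K₂ : Set (EuclideanSpace ℝ (Fin n))) := hx
      change _ ∈ (K₂ : Set (EuclideanSpace ℝ (Fin n)))
      rw [hK₂] at hx2 ⊢
      obtain ⟨⟨hxK, h1⟩, h2⟩ := hx2
      replace h1 : b ≤ ℓ x := h1
      replace h2 : b - ℓ ((2 : ℝ) • c) ≤ -(ℓ x) := h2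
      refine ⟨⟨hsym x hxK, ?_⟩, ?_⟩
      · change b ≤ ℓ ((2 : ℝ) • c - x)
        rw [map_sub]; linarith
      · change b - ℓ ((2 : ℝ) • c) ≤ -(ℓ ((2 : ℝ) • c - x))
        rw [map_sub]; linarith
    · have := dist_triangle K₂ K₁ K
      linarith
    · rw [Set.sdiff_eq_empty.mpr hsubK, measureReal_empty, add_zero]
      have : 0 < C * s ^ (n + 1) := by positivity
      linarith
    · have h1 := integral_inter_add_sdiff (μ := volume)
        (s := (K : Set (EuclideanSpace ℝ (Fin n)))) K₂.isCompact.measurableSet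
        (hφi _ K.isCompact)
      rw [Set.inter_eq_right.mpr hsubK] at h1
      linarith
  · refine not_eventually_perturbation hn hK (fun _ h => h.1) hmax (c := 2 * γ) (C := 2 * C)
      (by positivity) (by positivity) ?_
    filter_upwards [hev, eventually_mul_lt (C := C) hXX'] with s hs hsX
    obtain ⟨p, hp, hsub, hvol, hint⟩ := hs
    rw [finrank_euclideanSpace_fin] at hvol hint
    set J := convexJoin ℝ {p} (K : Set (EuclideanSpace ℝ (Fin n))) with hJ
    set J' := convexJoin ℝ {(2 : ℝ) • c - p} (K : Set (EuclideanSpace ℝ (Fin n))) with hJ'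
    obtain ⟨K₁, hK₁, hd₁⟩ := K.exists_join hXK p
    have hsub₁ : (K : Set (EuclideanSpace ℝ (Fin n))) ⊆ J := subset_convexJoin_right (by simp)
    have hX'₁ : X' ∈ K₁ := by
      change X' ∈ (K₁ : Set (EuclideanSpace ℝ (Fin n)))
      rw [hK₁]
      exact hsub₁ (hsym X hXK)
    obtain ⟨K₂, hK₂, hd₂⟩ := K₁.exists_join hX'₁ ((2 : ℝ) • c - p)
    -- Joining the second apex to the already enlarged body adds only its own spike over K, so the
    -- added region is a spike and its reflection.
    rw [hK₁, K.convex.convexJoin_reflect_eq_union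
      (interior_subset (hsym.center_mem_interior hK)), ← hJ, ← hJ'] at hK₂
    have hsubK : (K : Set (EuclideanSpace ℝ (Fin n))) ⊆ K₂ := by
      rw [hK₂]; exact hsub₁.trans Set.subset_union_left
    have hJσ : ∀ x, (2 : ℝ) • c - x ∈ J ↔ x ∈ J' := by
      intro x
      constructor <;> intro hx
      · have := mem_convexJoin_reflect hsym hx
        rwa [sub_sub_cancel] at this
      · have := mem_convexJoin_reflect hsym hx
        rwa [sub_sub_cancel] at this
    have hdiff : (K₂ : Set (EuclideanSpace ℝ (Fin n))) \ K =
        (J \ K) ∪ (fun x => (2 : ℝ) • c - x) ⁻¹' (J \ K) := by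
      have e : (fun x => (2 : ℝ) • c - x) ⁻¹' J = J' := Set.ext hJσ
      rw [Set.preimage_sdiff, hsym.preimage_eq, e, hK₂, Set.union_sdiff_distrib]
    have hJc : IsCompact J := K.isCompact.convexJoin_singleton p
    obtain ⟨hI, hv⟩ := setIntegral_union_reflect hφσ
      (hJc.measurableSet.diff K.isCompact.measurableSet)
      ((hφi _ hJc).mono_set Set.sdiff_subset)
      hsub
      (by rw [← hX']; linarith)
    rw [← hdiff] at hI hv
    refine ⟨K₂, ⟨⟨k₀, interior_mono hsubK hk₀⟩, fun x hx => ?_⟩, ?_, ?_, ?_⟩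
    · have hx2 : x ∈ (K₂ : Set (EuclideanSpace ℝ (Fin n))) := hx
      change _ ∈ (K₂ : Set (EuclideanSpace ℝ (Fin n)))
      rw [hK₂] at hx2 ⊢
      rcases hx2 with hx2 | hx2
      · right
        rwa [← hJσ, sub_sub_cancel]
      · left
        rwa [hJσ]
    · have h1 := dist_triangle K₂ K₁ K
      rw [show (2 : ℝ) • c - p - X' = -(p - X) by rw [hX']; module, norm_neg] at hd₂
      linarith
    · rw [Set.sdiff_eq_empty.mpr hsubK, measureReal_empty, zero_add]
      linarith
    · have h1 := integral_inter_add_sdiff (μ := volume)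
        (s := (K₂ : Set (EuclideanSpace ℝ (Fin n)))) K.isCompact.measurableSet
        (hφi _ K₂.isCompact)
      rw [Set.inter_eq_right.mpr hsubK] at h1
      linarith

end Symmetric

end LocalMaximizers

theorem theorem1 (n : ℕ) (hn : 2 ≤ n) (K : ConvexBody (EuclideanSpace ℝ (Fin n)))
    (hK : K ∈ properBodies n) :
    (IsLocalMaxOn isotropyConstant (properBodies n) K →
      ∀ X₀ ∈ frontier (K : Set (EuclideanSpace ℝ (Fin n))),
        ¬ HasPositiveGeneralizedCurvatureAt K X₀) ∧
    (∀ c : EuclideanSpace ℝ (Fin n), IsSymmetricAbout c K →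
      IsLocalMaxOn isotropyConstant {K' ∈ properBodies n | IsSymmetricAbout c K'} K →
      ∀ X₀ ∈ frontier (K : Set (EuclideanSpace ℝ (Fin n))),
        ¬ HasPositiveGeneralizedCurvatureAt K X₀) := by
  exact ⟨fun hmax X₀ _ hcurv => not_isLocalMaxOn_of_curvature hn hK hcurv hmax,
    fun c hsym hmax X₀ _ hcurv =>
      not_isLocalMaxOn_symmetric_of_curvature hn hK hsym hcurv hmax⟩
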